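/- A ribbon graph $G=(V,E)$ is a (compact) surface with boundary, represented as the union of a finite set $V$ of vertex discs and a finite set $E$ of edge discs, such that vertices and edges meet in disjoint line segments, each such segment lies on the boundary of exactly one vertex and exactly one edge, and each edge contains exactly two such segments. Ribbon graphs are considered up to homeomorphisms preserving this structure. For $A\subseteq E$ let $f(A)$ and $k(A)$ be the numbers of boundary components and of connected components of the spanning ribbon subgraph $(V,A)$, and put $k(G)=k(E)$. An edge $e$ is a bridge if $k(E\setminus\{e\})>k(G)$, and a loop if it is incident with exactly one vertex. A loop is non-orientable if, together with its vertex, it forms a Möbius band, and orientable otherwise. Two cycles $C_1,C_2$ of $G$ are interlaced if they have exactly one common vertex $v$ and are met in the cyclic order $C_1\,C_2\,C_1\,C_2$ when travelling around the boundary of $v$; a loop is trivial if it is interlaced with no cycle of $G$. Let $D(G)=(E,\mathcal F)$ with $\mathcal F=\{A\subseteq E : f(A)=k(G)\}$ be the delta-matroid of $G$. For a delta-matroid $D=(E,\mathcal F)$ and $e\in E$: $e$ is a loop (coloop) of $D$ if it lies in no (every) set of $\mathcal F$; $D_{\min}=(E,\mathcal F_{\min})$, where $\mathcal F_{\min}$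 consists of the members of $\mathcal F$ of minimum cardinality; $D*e=(E,\{F\bigtriangleup \{e\} : F\in\mathcal F\})$; $e$ is a ribbon loop of $D$ if it is a loop of $D_{\min}$; a ribbon loop $e$ of $D$ is non-orientable if it is also a ribbon loop of $D*e$, and orientable otherwise; an orientable ribbon loop $e$ is trivial if it lies in no set of $\mathcal F$; a non-orientable ribbon loop $e$ is trivial if $F\bigtriangleup\{e\}\in\mathcal F$ for every $F\in\mathcal F$. Proposition. Let $G$ be a ribbon graph and $e\in E$. Then 1. $e$ is a loop of $G$ if and only if $e$ is a ribbon loop of $D(G)$; 2. $e$ is an orientable loop of $G$ if and only if $e$ is an orientable ribbon loop of $D(G)$; 3. $e$ is a trivial loop of $G$ if and only if $e$ is a trivial ribbon loop of $D(G)$; 4. $e$ is a coloop of $D(G)$ if and only if $e$ is a bridge of $G$; 5. $e$ is a loop of $D(G)$ if and only if $e$ is a trivial orientable loop of $G$. -/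

import Mathlib

/-- A (finite) set system on the ground set `E`, given by its feasible sets. -/
structure SetSystem (E : Type*) where
  Feasible : Set E → Prop

namespace SetSystem

variable {E : Type*}

/-- The twist `D * A`: its feasible sets are the sets `A ∆ X` with `X` feasible in `D`. -/
def twist (D : SetSystem E) (A : Set E) : SetSystem E where
  Feasible F := ∃ X, D.Feasible X ∧ F = symmDiff A X

/-- `D_min`: the feasible sets of `D` of minimum cardinality. -/
def lower (D : SetSystem E) : SetSystem E where
  Feasible F := D.Feasible F ∧ ∀ F', D.Feasible F' → F.ncard ≤ F'.ncard

/-- A loop is an element that lies in no feasible set. -/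
def IsLoop (D : SetSystem E) (e : E) : Prop :=
  ∀ F, D.Feasible F → e ∉ F

/-- A coloop is an element that lies in every feasible set. -/
def IsColoop (D : SetSystem E) (e : E) : Prop :=
  ∀ F, D.Feasible F → e ∈ F

/-- A ribbon loop of `D` is a loop of `D_min`. -/
def IsRibbonLoop (D : SetSystem E) (e : E) : Prop :=
  D.lower.IsLoop e

/-- A ribbon loop `e` of `D` is non-orientable if it is also a ribbon loop of `D * e`. -/
def IsNonorientableRibbonLoop (D : SetSystem E) (e : E) : Prop :=
  D.IsRibbonLoop e ∧ (D.twist {e}).IsRibbonLoop e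

/-- A ribbon loop is orientable if it is not non-orientable. -/
def IsOrientableRibbonLoop (D : SetSystem E) (e : E) : Prop :=
  D.IsRibbonLoop e ∧ ¬ (D.twist {e}).IsRibbonLoop e

/-- An orientable ribbon loop is trivial if it lies in no feasible set; a non-orientable ribbon
loop `e` is trivial if `F ∆ e` is feasible for every feasible `F`. -/
def IsTrivialRibbonLoop (D : SetSystem E) (e : E) : Prop :=
  (D.IsOrientableRibbonLoop e ∧ ∀ F, D.Feasible F → e ∉ F) ∨
  (D.IsNonorientableRibbonLoop e ∧ ∀ F, D.Feasible F → D.Feasible (symmDiff F {e}))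

end SetSystem

/-- A ribbon graph with vertex set `V` and edge set `E`, up to equivalence, described by a signed
rotation system.

The edge disc `e` meets the vertex discs in two line segments, the half-edges `(e, false)` and
`(e, true)`. The half-edge `h` lies on the boundary of the vertex disc `vert h`. After choosing a
direction of travel around the boundary of each vertex disc, `rot h` is the half-edge met
immediately after `h`; so the half-edges on one vertex form one cycle of `rot`. A vertex may carry
no half-edges. Finally `twisted e` records whether the band `e` is attached
with a half-twist relative to the chosen directions at its two ends. -/
structure RibbonGraph (V E : Type*) where
  vert : E × Bool → V
  rot : Equiv.Perm (E × Bool)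
  vert_eq_iff : ∀ h h', vert h = vert h' ↔ rot.SameCycle h h'
  twisted : E → Bool

namespace RibbonGraph

variable {V E : Type*} (G : RibbonGraph V E)

/-- `u` and `v` are the end vertices of an edge of `A`. -/
def Joined (A : Set E) (u v : V) : Prop :=
  ∃ e ∈ A, G.vert (e, false) = u ∧ G.vert (e, true) = v

/-- `k(A)`: the number of connected components of the spanning ribbon subgraph `(V, A)`.
(`Quot` is the quotient by the equivalence relation generated by the given relation.) -/
noncomputable def k (A : Set E) : ℕ :=
  Nat.card (Quot (G.Joined A))

/-- The boundary of the spanning ribbon subgraph `(V, A)` is a union of arcs between the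
endpoints of half-edges (and of whole boundary circles of vertices without half-edges).
The segment `h` has the two endpoints `(h, false)` and `(h, true)`, in the order in which they are
met when travelling around `vert h`. The arcs are of three kinds:
* `corner`: the arc of the vertex boundary from the segment `h` to the next segment `rot h`;
* `free`: the segment `h` itself, if its edge is not in `A`;
* `side`: one of the two sides of an edge `e ∈ A`. A side of an untwisted edge joins the first
  endpoint of one of the segments of `e` to the second endpoint of the other one,
  a side of a twisted edge joins the first to the first, or the second to the second. -/
inductive BoundaryArc (A : Set E) : (E × Bool) × Bool → (E × Bool) × Bool → Prop
  | corner (h : E × Bool) : BoundaryArc A (h, true) (G.rot h, false)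
  | free (h : E × Bool) (hA : h.1 ∉ A) : BoundaryArc A (h, false) (h, true)
  | side (e : E) (hA : e ∈ A) (s : Bool) :
      BoundaryArc A ((e, false), s) ((e, true), xor s (!(G.twisted e)))

/-- `f(A)`: the number of boundary components of the spanning ribbon subgraph `(V, A)`. Each
vertex that carries no half-edge of `G` contributes one further boundary component. -/
noncomputable def f (A : Set E) : ℕ :=
  Nat.card (Quot (G.BoundaryArc A)) + Nat.card {v : V // ∀ h, G.vert h ≠ v}

/-- `D(G)`: the feasible sets are the edge sets `A` with `f(A) = k(G)`, that is, the edge sets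
of the spanning quasi-trees of `G`. -/
noncomputable def D : SetSystem E where
  Feasible A := G.f A = G.k Set.univ

/-- `e` is a bridge if `k(G \ e) > k(G)`. -/
def IsBridge (e : E) : Prop :=
  G.k Set.univ < G.k {e}ᶜ

/-- A loop is an edge that is incident with exactly one vertex. -/
def IsLoop (e : E) : Prop :=
  G.vert (e, false) = G.vert (e, true)

/-- An orientable loop: the band is attached without a half-twist to a single disc, so that the
loop is an annulus. A loop with a half-twist is a Möbius band. -/
def IsOrientableLoop (e : E) : Prop :=
  G.IsLoop e ∧ G.twisted e = false

/-- `C` is the edge set of a cycle of `G`: its edges can be traversed cyclically, passing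
through distinct vertices. (Addition in `Fin (n + 1)` is cyclic; loops are the cycles with
`n = 0`.) -/
def IsCycle (C : Set E) : Prop :=
  ∃ (n : ℕ) (h : Fin (n + 1) → E × Bool),
    Function.Injective (fun i => (h i).1) ∧
    Function.Injective (fun i => G.vert (h i)) ∧
    (∀ i, G.vert ((h i).1, !(h i).2) = G.vert (h (i + 1))) ∧
    C = Set.range (fun i => (h i).1)

/-- The vertices that are incident with an edge of `C`. -/
def vertices (C : Set E) : Set V :=
  {v | ∃ h : E × Bool, h.1 ∈ C ∧ G.vert h = v}

/-- The half-edges `a, b, c, d` lie on one vertex, are distinct, and are met in the cyclic order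
`a b c d` when travelling around its boundary. -/
def CyclicOrder (a b c d : E × Bool) : Prop :=
  ∃ i j k : ℕ, 0 < i ∧ i < j ∧ j < k ∧ k < Function.minimalPeriod G.rot a ∧
    G.rot^[i] a = b ∧ G.rot^[j] a = c ∧ G.rot^[k] a = d

/-- Two cycles are interlaced if they share exactly one vertex `v` and are met in the cyclic
order `C₁ C₂ C₁ C₂` around `v`. -/
def Interlaced (C₁ C₂ : Set E) : Prop :=
  ∃ v, G.vertices C₁ ∩ G.vertices C₂ = {v} ∧
    ∃ a b c d : E × Bool, a.1 ∈ C₁ ∧ b.1 ∈ C₂ ∧ c.1 ∈ C₁ ∧ d.1 ∈ C₂ ∧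
      G.vert a = v ∧ G.CyclicOrder a b c d

/-- A loop is trivial if it is interlaced with no cycle of `G`. -/
def IsTrivialLoop (e : E) : Prop :=
  G.IsLoop e ∧ ∀ C, G.IsCycle C → ¬ G.Interlaced {e} C

end RibbonGraph

/-! Everything rests on how f changes when one edge e is added to A. Without the arcs on e, the
boundary of (V, A) consists of closed curves and two paths, which pair the four ends of the segments
of e (`exists_partner`). One of three pairings occurs (`cutArc_pairing`); together with the
half-twist of e it decides whether f drops by one, stays or grows by one (the lemmas
`f_insert_of_pairing_segments`, `f_insert_of_pairing_parallel`, `f_insert_of_pairing_crossing`).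

Every component has a boundary curve, so k(A) ≤ f(A), and a feasible set has as many components as
G. Forests satisfy f = k, so the feasible sets of minimum size are the forests with k(G) components
(`lower_feasible_iff`). Such a forest extends any single non-loop edge and can avoid any single
non-bridge; this gives claims 1 and 4.

For a loop e, split its vertex in two along the strip between the segments of e. If A leaves the two
halves disconnected, the pairing is the crossing one and f(A ∪ e) is f(A) + 1 for an untwisted e and
f(A) for a twisted one (`Separates.f_insert`). Forests always leave them disconnected, so f(T ∪ e)
detects the half-twist, which gives claim 2. A path between the halves in the split graph is the
same thing as a cycle interlaced with e, so e is trivial exactly when E \ e leaves the halves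
disconnected (`IsGap.isTrivialLoop_iff`). In that case the formula holds for all A avoiding e and
yields triviality in D(G). Otherwise an untwisted e lies in a quasi-tree made of a spanning forest,
e and one more edge (`IsGap.exists_quasiTree`); a twisted e is first untwisted, and the pairing
transfers the conclusion back (`IsGap.exists_feasible_symmDiff`). Claims 3 and 5 follow. -/

open Relation

/-! ### Counting classes of generated equivalence relations -/

section Classes

variable {X Y : Type*}

theorem eqvGen_of_le {r s : X → X → Prop} (h : ∀ x y, r x y → EqvGen s x y) {x y : X}
    (hxy : EqvGen r x y) : EqvGen s x y := by
  induction hxy with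
  | rel x y hr => exact h x y hr
  | refl x => exact .refl x
  | symm _ _ _ ih => exact ih.symm
  | trans _ _ _ _ _ ih₁ ih₂ => exact ih₁.trans _ _ _ ih₂

theorem eqvGen_map {r : X → X → Prop} {s : Y → Y → Prop} (g : X → Y)
    (h : ∀ x y, r x y → EqvGen s (g x) (g y)) {x y : X} (hxy : EqvGen r x y) :
    EqvGen s (g x) (g y) := by
  induction hxy with
  | rel x y hr => exact h x y hr
  | refl x => exact .refl _
  | symm _ _ _ ih => exact ih.symm
  | trans _ _ _ _ _ ih₁ ih₂ => exact ih₁.trans _ _ _ ih₂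

theorem eqvGen_of_eq {r : X → X → Prop} {x y : X} (h : x = y) : EqvGen r x y :=
  h ▸ .refl x

theorem quot_mk_eq_iff {r : X → X → Prop} {x y : X} :
    Quot.mk r x = Quot.mk r y ↔ EqvGen r x y :=
  ⟨Quot.eqvGen_exact, Quot.eqvGen_sound⟩

theorem card_quot_congr {r s : X → X → Prop} (h : ∀ x y, r x y → EqvGen s x y)
    (h' : ∀ x y, s x y → EqvGen r x y) : Nat.card (Quot r) = Nat.card (Quot s) := by
  refine Nat.card_congr ⟨Quot.lift (Quot.mk s) fun x y hr => Quot.eqvGen_sound (h x y hr),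
    Quot.lift (Quot.mk r) fun x y hr => Quot.eqvGen_sound (h' x y hr), ?_, ?_⟩
  · rintro ⟨x⟩; rfl
  · rintro ⟨x⟩; rfl

/-- The relation `r` with the pair `(x, y)` adjoined. -/
def AdjoinPair (r : X → X → Prop) (x y : X) (u v : X) : Prop :=
  r u v ∨ (u = x ∧ v = y)

theorem AdjoinPair.of_base {r : X → X → Prop} {x y u v : X} (h : EqvGen r u v) :
    EqvGen (AdjoinPair r x y) u v :=
  eqvGen_of_le (fun _ _ hr => .rel _ _ (Or.inl hr)) h

theorem AdjoinPair.pair (r : X → X → Prop) (x y : X) : EqvGen (AdjoinPair r x y) x y :=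
  .rel _ _ (Or.inr ⟨rfl, rfl⟩)

theorem card_adjoinPair_of_eqvGen {r : X → X → Prop} {x y : X} (h : EqvGen r x y) :
    Nat.card (Quot (AdjoinPair r x y)) = Nat.card (Quot r) := by
  refine card_quot_congr ?_ fun u v hr => .rel _ _ (Or.inl hr)
  rintro u v (hr | ⟨rfl, rfl⟩)
  exacts [.rel _ _ hr, h]

/-- The merged classes correspond to the old classes other than that of `x`, the class of `x` being
sent to that of `y`. -/
theorem card_adjoinPair_of_not_eqvGen [Finite X] {r : X → X → Prop} {x y : X}
    (h : ¬ EqvGen r x y) :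
    Nat.card (Quot (AdjoinPair r x y)) + 1 = Nat.card (Quot r) := by
  classical
  have hne : Quot.mk r y ≠ Quot.mk r x := fun hh => h (quot_mk_eq_iff.1 hh.symm)
  let g : X → {z : Quot r // z ≠ Quot.mk r x} := fun u =>
    if hu : Quot.mk r u = Quot.mk r x then ⟨Quot.mk r y, hne⟩ else ⟨Quot.mk r u, hu⟩
  have hg : ∀ u v, AdjoinPair r x y u v → g u = g v := by
    rintro u v (hr | ⟨rfl, rfl⟩)
    · have : Quot.mk r u = Quot.mk r v := Quot.sound hr
      simp only [g, this]
    · simp only [g, dif_pos, dif_neg hne]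
  have hequiv : Quot (AdjoinPair r x y) ≃ {z : Quot r // z ≠ Quot.mk r x} := by
    refine ⟨Quot.lift g hg, fun z => Quot.lift (Quot.mk _)
      (fun u v hr => Quot.sound (Or.inl hr)) z.1, ?_, ?_⟩
    · rintro ⟨u⟩
      change Quot.lift (Quot.mk (AdjoinPair r x y)) _ (g u).1 = Quot.mk _ u
      by_cases hu : Quot.mk r u = Quot.mk r x
      · simp only [g, dif_pos hu]
        have h1 := AdjoinPair.of_base (x := x) (y := y) (quot_mk_eq_iff.1 hu)
        exact quot_mk_eq_iff.2 ((h1.trans _ _ _ (AdjoinPair.pair r x y)).symm)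
      · simp only [g, dif_neg hu]
    · rintro ⟨⟨u⟩, hu⟩
      change g u = _
      simp only [g]
      exact dif_neg hu
  rw [Nat.card_congr hequiv]
  have : 0 < Nat.card (Quot r) := @Nat.card_pos _ ⟨Quot.mk r x⟩ _
  have h2 : Nat.card {z : Quot r // z ≠ Quot.mk r x} = Nat.card (Quot r) - 1 := by
    have := Fintype.ofFinite (Quot r)
    simp [Nat.card_eq_fintype_card, Fintype.card_subtype_compl]
  omega

/-- Adjoining two pairs that are already related. -/
theorem card_adjoinPair_adjoinPair_of_eqvGen {r : X → X → Prop} {x y z w : X}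
    (hxy : EqvGen r x y) (hzw : EqvGen r z w) :
    Nat.card (Quot (AdjoinPair (AdjoinPair r x y) z w)) = Nat.card (Quot r) := by
  rw [card_adjoinPair_of_eqvGen (AdjoinPair.of_base hzw), card_adjoinPair_of_eqvGen hxy]

/-- Adjoining two pairs that both join the class of `x` and `y` to the class of `z` and `w`. -/
theorem card_adjoinPair_adjoinPair_of_not_eqvGen [Finite X] {r : X → X → Prop} {x y z w : X}
    (hxy : EqvGen r x y) (hzw : EqvGen r z w) (hxz : ¬ EqvGen r x z) :
    Nat.card (Quot (AdjoinPair (AdjoinPair r x z) y w)) + 1 = Nat.card (Quot r) := by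
  rw [card_adjoinPair_of_eqvGen, card_adjoinPair_of_not_eqvGen hxz]
  exact (AdjoinPair.of_base hxy.symm).trans _ _ _
    ((AdjoinPair.pair r x z).trans _ _ _ (AdjoinPair.of_base hzw))

end Classes

/-! ### Paths formed by two fixed-point-free involutions -/

section Involutions

variable {X : Type*}

/-- The graph with an edge from every `x` to `m₁ x` and from every `x ∉ Q` to `m₂ x`. -/
def InvolutionArc (m₁ m₂ : X → X) (Q : Set X) (x y : X) : Prop :=
  y = m₁ x ∨ (x ∉ Q ∧ y = m₂ x)

/-- The classes of `InvolutionArc m₁ m₂ Q` pair off the elements of `Q`. -/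
theorem exists_partner [Finite X] {m₁ m₂ : X → X} (h₁ : Function.Involutive m₁)
    (h₂ : Function.Involutive m₂) (f₁ : ∀ x, m₁ x ≠ x) (f₂ : ∀ x, m₂ x ≠ x) {Q : Set X}
    (hQ : ∀ x ∈ Q, m₂ x ∈ Q) {b : X} (hb : b ∈ Q) :
    ∃ c ∈ Q, c ≠ b ∧ EqvGen (InvolutionArc m₁ m₂ Q) b c ∧
      ∀ q ∈ Q, EqvGen (InvolutionArc m₁ m₂ Q) b q → q = b ∨ q = c := by
  classical
  -- Walk from `b`, applying `m₁` and `m₂` alternately, until an `m₁`-step first lands in `Q`; that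
  -- point is the partner.
  let x : ℕ → X := fun n => (m₂ ∘ m₁)^[n] b
  have hx0 : x 0 = b := rfl
  have hxs : ∀ n, x (n + 1) = m₂ (m₁ (x n)) := fun n => Function.iterate_succ_apply' _ _ _
  -- By finiteness the walk would return to `b`; the point just before the return is `m₂ b`, which
  -- lies in `Q`.
  have hex : ∃ n, m₁ (x n) ∈ Q := by
    have hinj : Function.Injective (m₂ ∘ m₁) := h₂.injective.comp h₁.injective
    have hper : b ∈ Function.periodicPts (m₂ ∘ m₁) := hinj.mem_periodicPts b
    obtain ⟨N, hN, hp⟩ := hper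
    obtain ⟨n, rfl⟩ : ∃ n, N = n + 1 := ⟨N - 1, by omega⟩
    refine ⟨n, ?_⟩
    have h : m₂ (m₁ (x n)) = b := by rw [← hxs]; exact hp
    rw [← h₂ (m₁ (x n)), h]
    exact hQ b hb
  obtain ⟨n, hn, hmin⟩ : ∃ n, m₁ (x n) ∈ Q ∧ ∀ j < n, m₁ (x j) ∉ Q :=
    ⟨Nat.find hex, Nat.find_spec hex, fun j hj => Nat.find_min hex hj⟩
  have hQ' : ∀ y, y ∉ Q → m₂ y ∉ Q := fun y hy h => hy (h₂ y ▸ hQ _ h)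
  refine ⟨m₁ (x n), hn, ?_, ?_, ?_⟩
  -- If the walk ended at `b` it would be a palindrome, and its midpoint would be a fixed point of
  -- `m₁` or of `m₂`, by the parity of `n`.
  · intro hpal
    have key : ∀ j ≤ n, m₁ (x (n - j)) = x j := by
      intro j
      induction j with
      | zero => intro _; exact hpal
      | succ j ih =>
        intro hj
        have h3 := ih (by omega)
        rw [show n - j = (n - (j + 1)) + 1 by omega] at h3
        rw [hxs j, ← h3, h₁, hxs, h₂]
    obtain ⟨j, hj | hj⟩ := Nat.even_or_odd' n
    · exact f₁ (x j) (by simpa [hj, two_mul] using key j (by omega))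
    · have h3 := key j (by omega)
      rw [show n - j = j + 1 by omega] at h3
      refine f₂ (x (j + 1)) ?_
      conv_rhs => rw [hxs, ← h3, h₁]
  · have key : ∀ j ≤ n, EqvGen (InvolutionArc m₁ m₂ Q) b (x j) := by
      intro j
      induction j with
      | zero => intro _; exact .refl _
      | succ j ih =>
        intro hj
        refine (ih (by omega)).trans _ _ _ (.trans _ (m₁ (x j)) _ (.rel _ _ (Or.inl rfl)) ?_)
        exact .rel _ _ (Or.inr ⟨hmin j (by omega), hxs j⟩)
    exact (key n le_rfl).trans _ _ _ (.rel _ _ (Or.inl rfl))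
  -- The visited points are closed under arcs in both directions, so they are the whole class of
  -- `b`; by minimality of `n` only the two ends lie in `Q`.
  · let P : X → Prop := fun y => ∃ j ≤ n, y = x j ∨ y = m₁ (x j)
    have hforward : ∀ y z, InvolutionArc m₁ m₂ Q y z → P y → P z := by
      rintro y z (rfl | ⟨hy, rfl⟩) ⟨j, hj, rfl | rfl⟩
      · exact ⟨j, hj, Or.inr rfl⟩
      · exact ⟨j, hj, Or.inl (h₁ _)⟩
      · cases j with
        | zero => exact absurd hb hy
        | succ j => exact ⟨j, by omega, Or.inr (by rw [hxs, h₂])⟩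
      · rcases hj.lt_or_eq with hj | rfl
        · exact ⟨j + 1, hj, Or.inl (hxs j).symm⟩
        · exact absurd hn hy
    have hsymm : ∀ y z, InvolutionArc m₁ m₂ Q y z → InvolutionArc m₁ m₂ Q z y := by
      rintro y z (rfl | ⟨hy, rfl⟩)
      · exact Or.inl (h₁ y).symm
      · exact Or.inr ⟨hQ' y hy, (h₂ y).symm⟩
    have hiff : ∀ {y z}, EqvGen (InvolutionArc m₁ m₂ Q) y z → (P y ↔ P z) := by
      intro y z h
      induction h with
      | rel y z h => exact ⟨hforward y z h, hforward z y (hsymm y z h)⟩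
      | refl => exact Iff.rfl
      | symm _ _ _ ih => exact ih.symm
      | trans _ _ _ _ _ ih₁ ih₂ => exact ih₁.trans ih₂
    intro q hq hbq
    obtain ⟨j, hj, rfl | rfl⟩ := (hiff hbq).1 ⟨0, by omega, Or.inl rfl⟩
    · cases j with
      | zero => exact Or.inl rfl
      | succ j =>
        refine absurd ?_ (hmin j (by omega))
        rw [← h₂ (m₁ (x j)), ← hxs]
        exact hQ _ hq
    · rcases hj.lt_or_eq with hj | rfl
      · exact absurd hq (hmin j hj)
      · exact Or.inr rfl

end Involutions

/-! ### Components of multigraphs -/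

section Multigraph

variable {W E : Type*}

/-- `p` and `q` are the two ends of an edge in `A`, where `u` and `w` assign to every edge its
ends. -/
def EndsIn (u w : E → W) (A : Set E) (p q : W) : Prop :=
  ∃ f ∈ A, u f = p ∧ w f = q

theorem EndsIn.mono {u w : E → W} {A B : Set E} (h : A ⊆ B) {p q : W}
    (hpq : EqvGen (EndsIn u w A) p q) : EqvGen (EndsIn u w B) p q :=
  eqvGen_of_le (fun _ _ ⟨f, hf, h'⟩ => .rel _ _ ⟨f, h hf, h'⟩) hpq

theorem card_endsIn_insert (u w : E → W) (A : Set E) (e : E) :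
    Nat.card (Quot (EndsIn u w (insert e A))) =
      Nat.card (Quot (AdjoinPair (EndsIn u w A) (u e) (w e))) := by
  refine card_quot_congr ?_ ?_
  · rintro _ _ ⟨f, rfl | hf, rfl, rfl⟩
    · exact AdjoinPair.pair _ _ _
    · exact .rel _ _ (Or.inl ⟨f, hf, rfl, rfl⟩)
  · rintro _ _ (⟨f, hf, rfl, rfl⟩ | ⟨rfl, rfl⟩)
    · exact .rel _ _ ⟨f, Or.inr hf, rfl, rfl⟩
    · exact .rel _ _ ⟨e, Or.inl rfl, rfl, rfl⟩

theorem card_endsIn_insert_of_not [Finite W] {u w : E → W} {A : Set E} {e : E}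
    (h : ¬ EqvGen (EndsIn u w A) (u e) (w e)) :
    Nat.card (Quot (EndsIn u w (insert e A))) + 1 = Nat.card (Quot (EndsIn u w A)) := by
  rw [card_endsIn_insert, card_adjoinPair_of_not_eqvGen h]

theorem card_endsIn_insert_of_eqvGen {u w : E → W} {A : Set E} {e : E}
    (h : EqvGen (EndsIn u w A) (u e) (w e)) :
    Nat.card (Quot (EndsIn u w (insert e A))) = Nat.card (Quot (EndsIn u w A)) := by
  rw [card_endsIn_insert, card_adjoinPair_of_eqvGen h]

theorem card_endsIn_empty (u w : E → W) : Nat.card (Quot (EndsIn u w ∅)) = Nat.card W := by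
  refine (Nat.card_congr ⟨Quot.mk _, Quot.lift id ?_, fun _ => rfl, ?_⟩).symm
  · rintro _ _ ⟨f, hf, _⟩
    exact hf.elim
  · rintro ⟨x⟩; rfl

/-- Each edge lowers the number of components by at most one. The case of equality serves below as
the definition of a forest. -/
theorem card_le_card_endsIn_add_ncard [Finite W] [Finite E] (u w : E → W) (A : Set E) :
    Nat.card W ≤ Nat.card (Quot (EndsIn u w A)) + A.ncard := by
  induction A, A.toFinite using Set.Finite.induction_on with
  | empty => simp [card_endsIn_empty]
  | @insert e A he _ ih =>
    rw [Set.ncard_insert_of_notMem he]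
    by_cases h : EqvGen (EndsIn u w A) (u e) (w e)
    · rw [card_endsIn_insert_of_eqvGen h]; omega
    · have := card_endsIn_insert_of_not h
      omega

theorem card_endsIn_anti [Finite W] (u w : E → W) {A B : Set E} (h : A ⊆ B) :
    Nat.card (Quot (EndsIn u w B)) ≤ Nat.card (Quot (EndsIn u w A)) := by
  refine Nat.card_le_card_of_surjective (Quot.lift (Quot.mk (EndsIn u w B)) ?_) ?_
  · rintro _ _ ⟨f, hf, h'⟩
    exact Quot.sound ⟨f, h hf, h'⟩
  · rintro ⟨x⟩
    exact ⟨Quot.mk _ x, rfl⟩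

/-- Every forest in `B` extends to a spanning forest of `B`. -/
theorem exists_spanning_forest [Finite W] [Finite E] (u w : E → W) {T B : Set E} (hTB : T ⊆ B)
    (hT : Nat.card (Quot (EndsIn u w T)) + T.ncard = Nat.card W) :
    ∃ T', T ⊆ T' ∧ T' ⊆ B ∧ Nat.card (Quot (EndsIn u w T')) + T'.ncard = Nat.card W ∧
      Nat.card (Quot (EndsIn u w T')) = Nat.card (Quot (EndsIn u w B)) := by
  by_cases h : ∀ f ∈ B, EqvGen (EndsIn u w T) (u f) (w f)
  · refine ⟨T, subset_rfl, hTB, hT, card_quot_congr ?_ ?_⟩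
    · rintro _ _ ⟨f, hf, h'⟩
      exact .rel _ _ ⟨f, hTB hf, h'⟩
    · rintro _ _ ⟨f, hf, rfl, rfl⟩
      exact h f hf
  · push Not at h
    obtain ⟨f, hfB, hf⟩ := h
    have hfT : f ∉ T := fun hfT => hf (.rel _ _ ⟨f, hfT, rfl, rfl⟩)
    have hdec : (B \ insert f T).ncard < (B \ T).ncard :=
      Set.ncard_lt_ncard ⟨Set.sdiff_subset_sdiff_right (Set.subset_insert f T),
        fun hh => (hh ⟨hfB, hfT⟩).2 (Set.mem_insert f T)⟩
    obtain ⟨T', h1, h2⟩ := exists_spanning_forest u w (T := insert f T) (B := B)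
      (Set.insert_subset hfB hTB) (by
        rw [Set.ncard_insert_of_notMem hfT]
        have := card_endsIn_insert_of_not hf
        omega)
    exact ⟨T', (Set.subset_insert f T).trans h1, h2⟩
termination_by (B \ T).ncard

end Multigraph

namespace RibbonGraph

variable {V E : Type*} (G : RibbonGraph V E)

/-! ### The boundary as a union of paths -/

/-- The involution that exchanges the two ends of every corner. -/
def cornerSwap (x : (E × Bool) × Bool) : (E × Bool) × Bool :=
  if x.2 then (G.rot x.1, false) else (G.rot.symm x.1, true)

open Classical in
/-- The involution that exchanges the two ends of every boundary arc of `(V, A)` that is not a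
corner. -/
noncomputable def bandSwap (A : Set E) (x : (E × Bool) × Bool) : (E × Bool) × Bool :=
  if x.1.1 ∈ A then ((x.1.1, !x.1.2), xor x.2 (!(G.twisted x.1.1))) else (x.1, !x.2)

/-- The boundary arcs of `(V, A)` other than those on the segments and sides of `e`. -/
def CutArc (A : Set E) (e : E) : (E × Bool) × Bool → (E × Bool) × Bool → Prop :=
  InvolutionArc G.cornerSwap (G.bandSwap A) {x | x.1.1 = e}

theorem cornerSwap_involutive : Function.Involutive G.cornerSwap := by
  rintro ⟨h, s⟩
  cases s <;> simp [cornerSwap]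

theorem cornerSwap_ne (x : (E × Bool) × Bool) : G.cornerSwap x ≠ x := by
  obtain ⟨h, s⟩ := x
  cases s <;> simp [cornerSwap]

theorem bandSwap_involutive (A : Set E) : Function.Involutive (G.bandSwap A) := by
  rintro ⟨⟨f, i⟩, s⟩
  by_cases hf : f ∈ A <;> simp [bandSwap, hf]

theorem bandSwap_ne (A : Set E) (x : (E × Bool) × Bool) : G.bandSwap A x ≠ x := by
  obtain ⟨⟨f, i⟩, s⟩ := x
  by_cases hf : f ∈ A <;> simp [bandSwap, hf]

theorem bandSwap_fst_fst (A : Set E) (x : (E × Bool) × Bool) :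
    (G.bandSwap A x).1.1 = x.1.1 := by
  unfold bandSwap
  split_ifs <;> rfl

/-- The boundary without the arcs of `e` joins the four ends of the two segments of `e`
in two pairs. -/
theorem cutArc_pairing [Finite E] (A : Set E) (e : E) :
    let r := EqvGen (G.CutArc A e)
    let a := ((e, false), false)
    let b := ((e, false), true)
    let c := ((e, true), false)
    let d := ((e, true), true)
    (r a b ∧ r c d ∧ ¬ r a c) ∨ (r a c ∧ r b d ∧ ¬ r a b) ∨ (r a d ∧ r b c ∧ ¬ r a b) := by
  intro r a b c d
  have key : ∀ x : (E × Bool) × Bool, x.1.1 = e → ∃ y : (E × Bool) × Bool, y.1.1 = e ∧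
      y ≠ x ∧ r x y ∧ ∀ q : (E × Bool) × Bool, q.1.1 = e → r x q → q = x ∨ q = y :=
    fun x hx => exists_partner G.cornerSwap_involutive (G.bandSwap_involutive A)
      G.cornerSwap_ne (G.bandSwap_ne A) (Q := {x | x.1.1 = e})
      (fun x hx => (G.bandSwap_fst_fst A x).trans hx) hx
  have hcases : ∀ x : (E × Bool) × Bool, x.1.1 = e → x = a ∨ x = b ∨ x = c ∨ x = d := by
    rintro ⟨⟨f, _ | _⟩, _ | _⟩ (rfl : f = e) <;> simp [a, b, c, d]
  have hab : a ≠ b := by simp [a, b]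
  have hac : a ≠ c := by simp [a, c]
  have had : a ≠ d := by simp [a, d]
  have hbc : b ≠ c := by simp [b, c]
  have hbd : b ≠ d := by simp [b, d]
  have hcd : c ≠ d := by simp [c, d]
  have rs : ∀ {x y}, r x y → r y x := fun h => h.symm
  have rt : ∀ {x y z}, r x y → r y z → r x z := fun h h' => h.trans _ _ _ h'
  -- Since each end is related to exactly one other end, the partner of `a` forces the remaining
  -- pair.
  obtain ⟨p, hp, hpa, hap, hpu⟩ := key a rfl
  rcases hcases p hp with rfl | rfl | rfl | rfl
  · exact absurd rfl hpa
  · left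
    have nac : ¬ r a c := fun h => by
      rcases hpu c rfl h with h | h
      exacts [hac h.symm, hbc h.symm]
    obtain ⟨q, hq, hqc, hcq, -⟩ := key c rfl
    refine ⟨hap, ?_, nac⟩
    rcases hcases q hq with rfl | rfl | rfl | rfl
    · exact absurd (rs hcq) nac
    · exact absurd (rt hap (rs hcq)) nac
    · exact absurd rfl hqc
    · exact hcq
  · right; left
    have nab : ¬ r a b := fun h => by
      rcases hpu b rfl h with h | h
      exacts [hab h.symm, hbc h]
    obtain ⟨q, hq, hqc, hcq, -⟩ := key b rfl
    refine ⟨hap, ?_, nab⟩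
    rcases hcases q hq with rfl | rfl | rfl | rfl
    · exact absurd (rs hcq) nab
    · exact absurd rfl hqc
    · exact absurd (rt hap (rs hcq)) nab
    · exact hcq
  · right; right
    have nab : ¬ r a b := fun h => by
      rcases hpu b rfl h with h | h
      exacts [hab h.symm, hbd h]
    obtain ⟨q, hq, hqc, hcq, -⟩ := key b rfl
    refine ⟨hap, ?_, nab⟩
    rcases hcases q hq with rfl | rfl | rfl | rfl
    · exact absurd (rs hcq) nab
    · exact absurd rfl hqc
    · exact hcq
    · exact absurd (rt hap (rs hcq)) nab

/-- `B` may differ from `A` at `e`, so that one relation `CutArc A e` describes the boundary both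
before and after adding `e`. -/
theorem cutArc_of_boundaryArc {A B : Set E} {e : E} (hAB : ∀ f, f ≠ e → (f ∈ B ↔ f ∈ A))
    {x y : (E × Bool) × Bool} (h : G.BoundaryArc B x y) :
    G.CutArc A e x y ∨ (e ∉ B ∧ ∃ i, x = ((e, i), false) ∧ y = ((e, i), true)) ∨
      (e ∈ B ∧ ∃ s, x = ((e, false), s) ∧ y = ((e, true), xor s (!(G.twisted e)))) := by
  cases h with
  | corner h => exact Or.inl (Or.inl (by simp [cornerSwap]))
  | free h hA =>
    obtain ⟨f, i⟩ := h
    by_cases hf : f = e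
    · subst hf
      exact Or.inr (Or.inl ⟨hA, i, rfl, rfl⟩)
    · exact Or.inl (Or.inr ⟨hf, by simp [bandSwap, ← hAB f hf, show f ∉ B from hA]⟩)
  | side f hA s =>
    by_cases hf : f = e
    · subst hf
      exact Or.inr (Or.inr ⟨hA, s, rfl, rfl⟩)
    · exact Or.inl (Or.inr ⟨hf, by simp [bandSwap, ← hAB f hf, hA]⟩)

theorem boundaryArc_of_cutArc {A B : Set E} {e : E} (hAB : ∀ f, f ≠ e → (f ∈ B ↔ f ∈ A))
    {x y : (E × Bool) × Bool} (h : G.CutArc A e x y) : EqvGen (G.BoundaryArc B) x y := by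
  obtain ⟨⟨f, i⟩, s⟩ := x
  rcases h with rfl | ⟨hf, rfl⟩
  · cases s
    · have := BoundaryArc.corner (G := G) (A := B) (G.rot.symm (f, i))
      rw [Equiv.apply_symm_apply] at this
      exact .symm _ _ (.rel _ _ (by simpa [cornerSwap] using this))
    · exact .rel _ _ (by simpa [cornerSwap] using BoundaryArc.corner (G := G) (f, i))
  · replace hf : f ≠ e := hf
    by_cases hA : f ∈ B
    · rw [bandSwap, if_pos ((hAB f hf).1 hA)]
      cases i
      · exact .rel _ _ (BoundaryArc.side f hA s)
      · refine .symm _ _ (.rel _ _ ?_)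
        have := BoundaryArc.side (G := G) f hA (xor s (!(G.twisted f)))
        rw [Bool.xor_assoc, Bool.xor_self, Bool.xor_false] at this
        exact this
    · rw [bandSwap, if_neg (mt (hAB f hf).2 hA)]
      cases s
      · exact .rel _ _ (BoundaryArc.free (f, i) hA)
      · exact .symm _ _ (.rel _ _ (BoundaryArc.free (f, i) hA))

theorem card_boundary_of_notMem {A : Set E} {e : E} (he : e ∉ A) :
    Nat.card (Quot (G.BoundaryArc A)) = Nat.card (Quot (AdjoinPair (AdjoinPair (G.CutArc A e)
      ((e, false), false) ((e, false), true)) ((e, true), false) ((e, true), true))) := by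
  refine card_quot_congr ?_ ?_
  · intro x y h
    rcases G.cutArc_of_boundaryArc (A := A) (e := e) (fun _ _ => Iff.rfl) h with
      h | ⟨-, i, rfl, rfl⟩ | ⟨h, -⟩
    · exact .rel _ _ (Or.inl (Or.inl h))
    · cases i
      · exact .rel _ _ (Or.inl (Or.inr ⟨rfl, rfl⟩))
      · exact .rel _ _ (Or.inr ⟨rfl, rfl⟩)
    · exact absurd h he
  · rintro x y ((h | ⟨rfl, rfl⟩) | ⟨rfl, rfl⟩)
    · exact G.boundaryArc_of_cutArc (fun _ _ => Iff.rfl) h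
    · exact .rel _ _ (BoundaryArc.free (e, false) he)
    · exact .rel _ _ (BoundaryArc.free (e, true) he)

theorem card_boundary_insert (A : Set E) (e : E) :
    Nat.card (Quot (G.BoundaryArc (insert e A))) =
      Nat.card (Quot (AdjoinPair (AdjoinPair (G.CutArc A e)
      ((e, false), false) ((e, true), !(G.twisted e)))
      ((e, false), true) ((e, true), G.twisted e))) := by
  have hAB : ∀ f, f ≠ e → (f ∈ insert e A ↔ f ∈ A) := fun f hf => by simp [hf]
  refine card_quot_congr ?_ ?_
  · intro x y h
    rcases G.cutArc_of_boundaryArc hAB h with h | ⟨h, -⟩ | ⟨-, s, rfl, rfl⟩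
    · exact .rel _ _ (Or.inl (Or.inl h))
    · exact absurd (Set.mem_insert e A) h
    · cases s
      · exact .rel _ _ (Or.inl (Or.inr ⟨rfl, by simp⟩))
      · exact .rel _ _ (Or.inr ⟨rfl, by simp⟩)
  · rintro x y ((h | ⟨rfl, rfl⟩) | ⟨rfl, rfl⟩)
    · exact G.boundaryArc_of_cutArc hAB h
    · have := BoundaryArc.side (G := G) e (Set.mem_insert e A) false
      exact .rel _ _ (by simpa using this)
    · have := BoundaryArc.side (G := G) e (Set.mem_insert e A) true
      exact .rel _ _ (by simpa using this)

/-! ### The effect of adding an edge on the number of boundary components -/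

/-- The two segments lie on different boundary curves, which the band merges whatever its twist. -/
theorem f_insert_of_pairing_segments [Finite E] {A : Set E} {e : E} (he : e ∉ A)
    (h₁ : EqvGen (G.CutArc A e) ((e, false), false) ((e, false), true))
    (h₂ : EqvGen (G.CutArc A e) ((e, true), false) ((e, true), true))
    (h₃ : ¬ EqvGen (G.CutArc A e) ((e, false), false) ((e, true), false)) :
    G.f (insert e A) + 1 = G.f A := by
  have hA := G.card_boundary_of_notMem he
  have hI := G.card_boundary_insert A e
  rw [card_adjoinPair_adjoinPair_of_eqvGen h₁ h₂] at hA
  have : Nat.card (Quot (G.BoundaryArc (insert e A))) + 1 = Nat.card (Quot (G.CutArc A e)) := by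
    rw [hI]
    cases ht : G.twisted e
    · exact card_adjoinPair_adjoinPair_of_not_eqvGen h₁ h₂.symm
        fun h => h₃ (h.trans _ _ _ h₂.symm)
    · exact card_adjoinPair_adjoinPair_of_not_eqvGen h₁ h₂ h₃
  unfold f
  omega

/-- The segments join the two paths into one curve. Untwisted sides again join them into one,
whereas twisted sides close up each path separately. -/
theorem f_insert_of_pairing_parallel [Finite E] {A : Set E} {e : E} (he : e ∉ A)
    (h₁ : EqvGen (G.CutArc A e) ((e, false), false) ((e, true), false))
    (h₂ : EqvGen (G.CutArc A e) ((e, false), true) ((e, true), true))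
    (h₃ : ¬ EqvGen (G.CutArc A e) ((e, false), false) ((e, false), true)) :
    G.f (insert e A) = G.f A + if G.twisted e then 1 else 0 := by
  have hA := G.card_boundary_of_notMem he
  have hI := G.card_boundary_insert A e
  have hA' := card_adjoinPair_adjoinPair_of_not_eqvGen h₁ h₂ h₃
  cases ht : G.twisted e <;> simp only [ht] at hI
  · have := card_adjoinPair_adjoinPair_of_not_eqvGen h₁ h₂.symm
      fun h => h₃ (h.trans _ _ _ h₂.symm)
    -- Adjoined pairs are ordered; reversing the second one matches the form in which the merging
    -- count was obtained.
    have hsymm : Nat.card (Quot (AdjoinPair (AdjoinPair (G.CutArc A e)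
      ((e, false), false) ((e, true), true)) ((e, false), true) ((e, true), false))) =
      Nat.card (Quot (AdjoinPair (AdjoinPair (G.CutArc A e)
      ((e, false), false) ((e, true), true)) ((e, true), false) ((e, false), true))) := by
      refine card_quot_congr ?_ ?_ <;>
      · rintro x y (h | ⟨rfl, rfl⟩)
        · exact .rel _ _ (Or.inl h)
        · exact .symm _ _ (.rel _ _ (Or.inr ⟨rfl, rfl⟩))
    unfold f
    simp only [Bool.not_false, Bool.false_eq_true, if_false] at *
    omega
  · have := card_adjoinPair_adjoinPair_of_eqvGen h₁ h₂
    unfold f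
    simp only [Bool.not_true, if_true] at *
    omega

/-- The roles of the twists are exchanged compared with the parallel pairing: here the untwisted
sides close up each path separately. -/
theorem f_insert_of_pairing_crossing [Finite E] {A : Set E} {e : E} (he : e ∉ A)
    (h₁ : EqvGen (G.CutArc A e) ((e, false), false) ((e, true), true))
    (h₂ : EqvGen (G.CutArc A e) ((e, false), true) ((e, true), false))
    (h₃ : ¬ EqvGen (G.CutArc A e) ((e, false), false) ((e, false), true)) :
    G.f (insert e A) = G.f A + if G.twisted e then 0 else 1 := by
  have hA := G.card_boundary_of_notMem he
  have hI := G.card_boundary_insert A e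
  have hA' := card_adjoinPair_adjoinPair_of_not_eqvGen h₁ h₂ h₃
  have hsymm : Nat.card (Quot (AdjoinPair (AdjoinPair (G.CutArc A e)
      ((e, false), false) ((e, false), true)) ((e, true), true) ((e, true), false))) =
      Nat.card (Quot (AdjoinPair (AdjoinPair (G.CutArc A e)
      ((e, false), false) ((e, false), true)) ((e, true), false) ((e, true), true))) := by
    refine card_quot_congr ?_ ?_ <;>
    · rintro x y (h | ⟨rfl, rfl⟩)
      · exact .rel _ _ (Or.inl h)
      · exact .symm _ _ (.rel _ _ (Or.inr ⟨rfl, rfl⟩))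
  cases ht : G.twisted e <;> simp only [ht] at hI
  · have := card_adjoinPair_adjoinPair_of_eqvGen h₁ h₂
    unfold f
    simp only [Bool.not_false, Bool.false_eq_true, if_false] at *
    omega
  · have h4 : Nat.card (Quot (AdjoinPair (AdjoinPair (G.CutArc A e)
        ((e, false), false) ((e, true), false)) ((e, true), true) ((e, false), true))) + 1 = _ :=
      card_adjoinPair_adjoinPair_of_not_eqvGen h₁ h₂.symm
        fun h => h₃ (h.trans _ _ _ h₂.symm)
    have hsymm' : Nat.card (Quot (AdjoinPair (AdjoinPair (G.CutArc A e)
      ((e, false), false) ((e, true), false)) ((e, true), true) ((e, false), true))) =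
      Nat.card (Quot (AdjoinPair (AdjoinPair (G.CutArc A e)
      ((e, false), false) ((e, true), false)) ((e, false), true) ((e, true), true))) := by
      refine card_quot_congr ?_ ?_ <;>
      · rintro x y (h | ⟨rfl, rfl⟩)
        · exact .rel _ _ (Or.inl h)
        · exact .symm _ _ (.rel _ _ (Or.inr ⟨rfl, rfl⟩))
    unfold f
    simp only [Bool.not_true, if_true] at *
    omega

/-- An edge whose segments lie on different boundary components merges them. -/
theorem f_insert_of_not_eqvGen [Finite E] {A : Set E} {e : E} (he : e ∉ A)
    (h : ¬ EqvGen (G.BoundaryArc A) ((e, false), false) ((e, true), false)) :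
    G.f (insert e A) + 1 = G.f A := by
  have hle : ∀ {x y}, EqvGen (G.CutArc A e) x y → EqvGen (G.BoundaryArc A) x y :=
    eqvGen_of_le fun x y hxy => G.boundaryArc_of_cutArc (fun _ _ => Iff.rfl) hxy
  rcases G.cutArc_pairing A e with ⟨h₁, h₂, h₃⟩ | ⟨h₁, -, -⟩ | ⟨h₁, -, -⟩
  · exact G.f_insert_of_pairing_segments he h₁ h₂ h₃
  · exact absurd (hle h₁) h
  · exact absurd ((hle h₁).trans _ _ _ (.symm _ _ (.rel _ _ (BoundaryArc.free (e, true) he)))) h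

/-! ### Comparison of boundary components and connected components -/

theorem vert_rot (h : E × Bool) : G.vert (G.rot h) = G.vert h :=
  (G.vert_eq_iff _ _).2 (Equiv.Perm.SameCycle.refl _ _).apply_left

theorem joined_eq (A : Set E) :
    G.Joined A = EndsIn (fun f => G.vert (f, false)) (fun f => G.vert (f, true)) A := rfl

theorem eqvGen_joined_of_boundaryArc {A : Set E} {x y : (E × Bool) × Bool}
    (h : EqvGen (G.BoundaryArc A) x y) : EqvGen (G.Joined A) (G.vert x.1) (G.vert y.1) := by
  refine eqvGen_map (fun x : (E × Bool) × Bool => G.vert x.1) ?_ h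
  intro x y h
  cases h with
  | corner h => exact eqvGen_of_eq (G.vert_rot h).symm
  | free h => exact .refl _
  | side f hA s => exact .rel _ _ ⟨f, hA, rfl, rfl⟩

/-- The connected component that contains a given boundary component. -/
def componentOf (A : Set E) :
    Quot (G.BoundaryArc A) ⊕ {v : V // ∀ h, G.vert h ≠ v} → Quot (G.Joined A) :=
  Sum.elim (Quot.lift (fun x => Quot.mk _ (G.vert x.1)) fun x y h =>
    quot_mk_eq_iff.2 (G.eqvGen_joined_of_boundaryArc (.rel x y h))) fun v => Quot.mk _ v.1

theorem componentOf_surjective (A : Set E) : Function.Surjective (G.componentOf A) := by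
  rintro ⟨v⟩
  by_cases hv : ∀ h, G.vert h ≠ v
  · exact ⟨Sum.inr ⟨v, hv⟩, rfl⟩
  · push Not at hv
    obtain ⟨h, rfl⟩ := hv
    exact ⟨Sum.inl (Quot.mk _ (h, false)), rfl⟩

theorem f_eq_card_sum [Finite V] [Finite E] (A : Set E) :
    G.f A = Nat.card (Quot (G.BoundaryArc A) ⊕ {v : V // ∀ h, G.vert h ≠ v}) := by
  rw [Nat.card_sum, f]

theorem k_le_f [Finite V] [Finite E] (A : Set E) : G.k A ≤ G.f A := by
  rw [f_eq_card_sum]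
  exact Nat.card_le_card_of_surjective _ (G.componentOf_surjective A)

theorem eq_of_eqvGen_joined_empty {u v : V} (h : EqvGen (G.Joined ∅) u v) : u = v := by
  induction h with
  | rel u v h => exact h.choose_spec.1.elim
  | refl => rfl
  | symm _ _ _ ih => exact ih.symm
  | trans _ _ _ _ _ ih₁ ih₂ => exact ih₁.trans ih₂

/-- With no bands, corners and free segments run once around each cycle of `rot`, that is, around
each vertex disc. -/
theorem f_empty [Finite V] [Finite E] : G.f ∅ = Nat.card V := by
  rw [← card_endsIn_empty (fun f => G.vert (f, false)) (fun f => G.vert (f, true)), ← joined_eq,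
    f_eq_card_sum]
  have hs : ∀ h s, EqvGen (G.BoundaryArc ∅) (h, s) (h, false) := by
    rintro h (_ | _)
    · exact .refl _
    · exact .symm _ _ (.rel _ _ (BoundaryArc.free h id))
  have hpow : ∀ (n : ℕ) h, EqvGen (G.BoundaryArc ∅) (h, false) ((G.rot ^ n) h, false) := by
    intro n
    induction n with
    | zero => intro h; exact .refl _
    | succ n ih =>
      intro h
      refine (ih h).trans _ _ _ ((hs _ true).symm.trans _ _ _ (.rel _ _ ?_))
      rw [pow_succ', Equiv.Perm.mul_apply]
      exact BoundaryArc.corner _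
  refine Nat.card_eq_of_bijective (G.componentOf ∅) ⟨?_, G.componentOf_surjective ∅⟩
  rintro (⟨⟨h, s⟩⟩ | ⟨v, hv⟩) (⟨⟨h', s'⟩⟩ | ⟨v', hv'⟩) heq
  · have := G.eq_of_eqvGen_joined_empty (quot_mk_eq_iff.1 heq)
    obtain ⟨n, -, hn⟩ := ((G.vert_eq_iff _ _).1 this).exists_pow_eq'
    refine congrArg Sum.inl (quot_mk_eq_iff.2 ?_)
    refine (hs h s).trans _ _ _ (.trans _ _ _ ?_ (hs h' s').symm)
    have h3 := hpow n h
    rwa [show (G.rot ^ n) h = h' from hn] at h3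
  · exact absurd (G.eq_of_eqvGen_joined_empty (quot_mk_eq_iff.1 heq)) (hv' h)
  · exact absurd (G.eq_of_eqvGen_joined_empty (quot_mk_eq_iff.1 heq)).symm (hv h')
  · have := G.eq_of_eqvGen_joined_empty (quot_mk_eq_iff.1 heq)
    exact congrArg Sum.inr (Subtype.ext this)

/-! ### Spanning forests and feasible sets -/

/-- The edge set `T` contains no cycle. -/
def IsForest (T : Set E) : Prop :=
  G.k T + T.ncard = Nat.card V

theorem k_anti [Finite V] {A B : Set E} (h : A ⊆ B) : G.k B ≤ G.k A :=
  card_endsIn_anti _ _ h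

theorem isForest_empty : G.IsForest ∅ := by
  unfold IsForest k
  rw [joined_eq, card_endsIn_empty, Set.ncard_empty, add_zero]

theorem k_insert_of_not [Finite V] {A : Set E} {e : E}
    (h : ¬ EqvGen (G.Joined A) (G.vert (e, false)) (G.vert (e, true))) :
    G.k (insert e A) + 1 = G.k A :=
  card_endsIn_insert_of_not h

theorem k_insert_of_eqvGen {A : Set E} {e : E}
    (h : EqvGen (G.Joined A) (G.vert (e, false)) (G.vert (e, true))) :
    G.k (insert e A) = G.k A :=
  card_endsIn_insert_of_eqvGen h

variable [Finite V] [Finite E]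

theorem card_le_k_add_ncard (A : Set E) : Nat.card V ≤ G.k A + A.ncard :=
  card_le_card_endsIn_add_ncard _ _ A

variable {G} in
theorem IsForest.exists_spanning {T B : Set E} (hT : G.IsForest T) (hTB : T ⊆ B) :
    ∃ T', T ⊆ T' ∧ T' ⊆ B ∧ G.IsForest T' ∧ G.k T' = G.k B :=
  exists_spanning_forest _ _ hTB hT

variable {G} in
theorem IsForest.of_insert {T : Set E} {e : E} (he : e ∉ T) (hT : G.IsForest (insert e T)) :
    G.IsForest T ∧ ¬ EqvGen (G.Joined T) (G.vert (e, false)) (G.vert (e, true)) := by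
  unfold IsForest at *
  rw [Set.ncard_insert_of_notMem he] at hT
  have h1 := G.card_le_k_add_ncard T
  by_cases h : EqvGen (G.Joined T) (G.vert (e, false)) (G.vert (e, true))
  · rw [G.k_insert_of_eqvGen h] at hT
    omega
  · have := G.k_insert_of_not h
    exact ⟨by omega, h⟩

variable {G} in
-- Adding a forest edge joins two components, hence two boundary curves, so both counts drop by one.
theorem IsForest.f_eq_k {T : Set E} (hT : G.IsForest T) : G.f T = G.k T := by
  induction T, T.toFinite using Set.Finite.induction_on with
  | empty =>
    rw [f_empty, ← hT, Set.ncard_empty, add_zero]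
  | @insert e T he _ ih =>
    obtain ⟨hT', h⟩ := IsForest.of_insert he hT
    have h1 := G.f_insert_of_not_eqvGen he fun hh => h (G.eqvGen_joined_of_boundaryArc hh)
    have h2 := G.k_insert_of_not h
    have h3 := ih hT'
    omega

variable {G} in
theorem IsForest.notMem_of_isLoop {T : Set E} {e : E} (hT : G.IsForest T) (he : G.IsLoop e) :
    e ∉ T := by
  intro heT
  have hT' : insert e (T \ {e}) = T := by simp [Set.insert_eq_of_mem heT]
  rw [← hT'] at hT
  exact (IsForest.of_insert (by simp) hT).2 (eqvGen_of_eq he)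

theorem k_eq_of_feasible {F : Set E} (hF : G.D.Feasible F) : G.k F = G.k Set.univ :=
  le_antisymm ((G.k_le_f F).trans (le_of_eq hF)) (G.k_anti (Set.subset_univ F))

variable {G} in
theorem IsForest.feasible {T : Set E} (hT : G.IsForest T) (hk : G.k T = G.k Set.univ) :
    G.D.Feasible T :=
  (IsForest.f_eq_k hT).trans hk

variable {G} in
theorem IsForest.ncard_le {T F : Set E} (hT : G.IsForest T) (hk : G.k T = G.k Set.univ)
    (hF : G.k F = G.k Set.univ) : T.ncard ≤ F.ncard := by
  have := G.card_le_k_add_ncard F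
  unfold IsForest at hT
  omega

/-- Given k(F) = k(G), the bound |V| ≤ k(F) + |F| is a lower bound on |F|. Spanning forests attain
it and are feasible, so the minimum sets are the sets with equality. -/
theorem lower_feasible_iff {F : Set E} :
    G.D.lower.Feasible F ↔ G.IsForest F ∧ G.k F = G.k Set.univ := by
  constructor
  · rintro ⟨hF, hmin⟩
    have hk := G.k_eq_of_feasible hF
    obtain ⟨T, -, -, hT, hTk⟩ :=
      IsForest.exists_spanning G.isForest_empty (Set.empty_subset Set.univ)
    have h1 := hmin T (IsForest.feasible hT hTk)
    have h2 := G.card_le_k_add_ncard F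
    refine ⟨?_, hk⟩
    unfold IsForest at *
    omega
  · rintro ⟨hF, hk⟩
    exact ⟨IsForest.feasible hF hk,
      fun F' hF' => IsForest.ncard_le hF hk (G.k_eq_of_feasible hF')⟩

theorem isLoop_iff_isRibbonLoop (e : E) : G.IsLoop e ↔ G.D.IsRibbonLoop e := by
  constructor
  · intro he F hF
    exact IsForest.notMem_of_isLoop (G.lower_feasible_iff.1 hF).1 he
  · intro he
    by_contra hl
    have hnot : ¬ EqvGen (G.Joined ∅) (G.vert (e, false)) (G.vert (e, true)) :=
      fun h => hl (G.eq_of_eqvGen_joined_empty h)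
    have hforest : G.IsForest (insert e ∅) := by
      have h1 := G.k_insert_of_not hnot
      have h2 := G.isForest_empty
      unfold IsForest at *
      rw [Set.ncard_insert_of_notMem (Set.notMem_empty e)]
      omega
    obtain ⟨T, h1, -, hT, hk⟩ := IsForest.exists_spanning hforest (Set.subset_univ _)
    exact he T (G.lower_feasible_iff.2 ⟨hT, hk⟩) (h1 (Set.mem_insert e ∅))

/-- If deleting `e` keeps k, a spanning forest of the rest is a feasible set avoiding `e`.
Conversely, a feasible set avoiding `e` shows that the rest has only k(G) components. -/
theorem isColoop_iff_isBridge (e : E) : G.D.IsColoop e ↔ G.IsBridge e := by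
  constructor
  · intro he
    by_contra hb
    have hk : G.k {e}ᶜ = G.k Set.univ :=
      le_antisymm (not_lt.1 hb) (G.k_anti (Set.subset_univ _))
    obtain ⟨T, -, hTe, hT, hTk⟩ :=
      IsForest.exists_spanning G.isForest_empty (Set.empty_subset {e}ᶜ)
    exact hTe (he T (IsForest.feasible hT (hTk.trans hk))) rfl
  · intro hb F hF
    by_contra heF
    have h1 := G.k_anti (A := F) (B := {e}ᶜ) (by simpa using heF)
    rw [G.k_eq_of_feasible hF] at h1
    exact absurd hb (not_lt.2 h1)

end RibbonGraph

namespace RibbonGraph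

variable {V E : Type*} (G : RibbonGraph V E)

/-! ### Splitting a vertex along a loop -/

/-- `m` is the number of steps from the first to the second segment of the loop `e` when
travelling around its vertex. -/
structure IsGap (e : E) (m : ℕ) : Prop where
  pos : 0 < m
  lt : m < Function.minimalPeriod G.rot (e, false)
  iterate : G.rot^[m] (e, false) = (e, true)

theorem vert_rot_iterate (n : ℕ) (h : E × Bool) : G.vert (G.rot^[n] h) = G.vert h := by
  induction n with
  | zero => rfl
  | succ n ih => rw [Function.iterate_succ_apply', vert_rot, ih]

theorem exists_iterate_of_vert_eq [Finite E] {h h' : E × Bool} (hv : G.vert h = G.vert h') :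
    ∃ n < Function.minimalPeriod G.rot h, G.rot^[n] h = h' := by
  obtain ⟨n, -, hn⟩ := ((G.vert_eq_iff _ _).1 hv).exists_pow_eq'
  have hpos : 0 < Function.minimalPeriod G.rot h :=
    Function.minimalPeriod_pos_of_mem_periodicPts (G.rot.injective.mem_periodicPts h)
  refine ⟨n % Function.minimalPeriod G.rot h, Nat.mod_lt _ hpos, ?_⟩
  rw [Function.iterate_mod_minimalPeriod_eq, Equiv.Perm.iterate_eq_pow]
  exact hn

theorem IsLoop.exists_isGap [Finite E] {G : RibbonGraph V E} {e : E} (he : G.IsLoop e) :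
    ∃ m, G.IsGap e m := by
  obtain ⟨m, hm, h⟩ := G.exists_iterate_of_vert_eq he
  refine ⟨m, Nat.pos_of_ne_zero ?_, hm, h⟩
  rintro rfl
  simp at h

/-- The point `x` is met after the first and before the second segment of the loop `e`, where
`m` is the number of steps between them. -/
def InGap (e : E) (m : ℕ) (x : (E × Bool) × Bool) : Prop :=
  ∃ i, G.rot^[i] (e, false) = x.1 ∧ if x.2 then i < m else 0 < i ∧ i ≤ m

open Classical in
/-- The vertex that contains the point `x` after the vertex of the loop `e` has been split into
two by deleting `e` and the strip between its segments. The new vertex is `none`. -/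
noncomputable def splitVert (e : E) (m : ℕ) (x : (E × Bool) × Bool) : Option V :=
  if G.InGap e m x then none else some (G.vert x.1)

/-- Adjacency in the graph obtained by splitting the vertex of the loop `e`. -/
noncomputable def SplitJoined (e : E) (m : ℕ) (A : Set E) : Option V → Option V → Prop :=
  EndsIn (fun f => G.splitVert e m ((f, false), true))
    (fun f => G.splitVert e m ((f, true), true)) A

theorem vert_eq_of_inGap {e : E} {m : ℕ} {x : (E × Bool) × Bool} (h : G.InGap e m x) :
    G.vert x.1 = G.vert (e, false) := by
  obtain ⟨i, hi, -⟩ := h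
  rw [← hi, vert_rot_iterate]

theorem splitVert_eq_or {e : E} {m : ℕ} (x : (E × Bool) × Bool) :
    (G.splitVert e m x = none ∧ G.vert x.1 = G.vert (e, false)) ∨
      G.splitVert e m x = some (G.vert x.1) := by
  by_cases h : G.InGap e m x
  · exact Or.inl ⟨if_pos h, G.vert_eq_of_inGap h⟩
  · exact Or.inr (if_neg h)

theorem splitVert_congr {e : E} {m : ℕ} {x y : (E × Bool) × Bool}
    (h : G.InGap e m x ↔ G.InGap e m y) (hv : G.vert x.1 = G.vert y.1) :
    G.splitVert e m x = G.splitVert e m y := by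
  by_cases hx : G.InGap e m x
  · exact (if_pos hx).trans (if_pos (h.1 hx)).symm
  · exact (if_neg hx).trans ((congrArg some hv).trans (if_neg (mt h.2 hx)).symm)

theorem getD_splitVert (e : E) (m : ℕ) (x : (E × Bool) × Bool) :
    (G.splitVert e m x).getD (G.vert (e, false)) = G.vert x.1 := by
  rcases G.splitVert_eq_or (e := e) (m := m) x with ⟨h, hv⟩ | h
  · rw [h, hv]; rfl
  · rw [h]; rfl

theorem inGap_corner (e : E) (m : ℕ) (h : E × Bool) :
    G.InGap e m (h, true) ↔ G.InGap e m (G.rot h, false) := by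
  constructor
  · rintro ⟨i, hi, him⟩
    simp only [if_true] at him hi
    refine ⟨i + 1, ?_, ?_⟩
    · rw [Function.iterate_succ_apply', hi]
    · simp; omega
  · rintro ⟨i, hi, him⟩
    simp only [Bool.false_eq_true, if_false] at him hi
    obtain ⟨j, rfl⟩ : ∃ j, i = j + 1 := ⟨i - 1, by omega⟩
    rw [Function.iterate_succ_apply'] at hi
    refine ⟨j, G.rot.injective hi, ?_⟩
    simp; omega

theorem splitVert_corner (e : E) (m : ℕ) (h : E × Bool) :
    G.splitVert e m (h, true) = G.splitVert e m (G.rot h, false) :=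
  G.splitVert_congr (G.inGap_corner e m h) (G.vert_rot h).symm

variable {G} in
-- The bounds in `InGap` for the two endpoints differ only at `i = 0` and `i = m`, the segments of
-- `e`; so only these segments are cut by the split.
theorem IsGap.splitVert_eq {e : E} {m : ℕ} (hm : G.IsGap e m) {h : E × Bool} (hh : h.1 ≠ e)
    (s : Bool) : G.splitVert e m (h, s) = G.splitVert e m (h, true) := by
  have key : G.InGap e m (h, false) ↔ G.InGap e m (h, true) := by
    constructor
    · rintro ⟨i, hi, him⟩
      simp only [Bool.false_eq_true, if_false] at him hi
      refine ⟨i, hi, ?_⟩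
      have : i ≠ m := by
        rintro rfl
        exact hh (by rw [← hi, hm.iterate])
      simp; omega
    · rintro ⟨i, hi, him⟩
      simp only [if_true] at him hi
      refine ⟨i, hi, ?_⟩
      have : i ≠ 0 := by
        rintro rfl
        exact hh (by rw [← hi]; rfl)
      simp; omega
  cases s
  · exact G.splitVert_congr key rfl
  · rfl

variable {G} in
theorem IsGap.splitVert_first_true {e : E} {m : ℕ} (hm : G.IsGap e m) :
    G.splitVert e m ((e, false), true) = none :=
  if_pos ⟨0, rfl, by simpa using hm.pos⟩

variable {G} in
theorem IsGap.splitVert_second_false {e : E} {m : ℕ} (hm : G.IsGap e m) :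
    G.splitVert e m ((e, true), false) = none :=
  if_pos ⟨m, hm.iterate, by simpa using hm.pos⟩

variable {G} in
theorem IsGap.splitVert_first_false {e : E} {m : ℕ} (hm : G.IsGap e m) :
    G.splitVert e m ((e, false), false) = some (G.vert (e, false)) := by
  refine if_neg ?_
  rintro ⟨i, hi, him⟩
  simp only [Bool.false_eq_true, if_false] at him hi
  have := Function.IsPeriodicPt.minimalPeriod_le (f := G.rot) him.1 hi
  have := hm.lt
  omega

variable {G} in
theorem IsGap.splitVert_second_true {e : E} {m : ℕ} (hm : G.IsGap e m) :
    G.splitVert e m ((e, true), true) = some (G.vert (e, false)) := by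
  have hv : G.vert (e, true) = G.vert (e, false) := by rw [← hm.iterate, vert_rot_iterate]
  rw [← hv]
  refine if_neg ?_
  rintro ⟨i, hi, him⟩
  simp only [if_true] at him hi
  rw [← hm.iterate] at hi
  have := Function.iterate_injOn_Iio_minimalPeriod (f := G.rot) (x := (e, false))
    (Set.mem_Iio.2 (him.trans hm.lt)) (Set.mem_Iio.2 hm.lt) hi
  omega

variable {G} in
theorem IsGap.splitJoined_of_cutArc {e : E} {m : ℕ} (hm : G.IsGap e m) {A : Set E}
    {x y : (E × Bool) × Bool} (h : EqvGen (G.CutArc A e) x y) :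
    EqvGen (G.SplitJoined e m A) (G.splitVert e m x) (G.splitVert e m y) := by
  refine eqvGen_map (G.splitVert e m) ?_ h
  rintro ⟨⟨f, i⟩, s⟩ y (rfl | ⟨hf, rfl⟩)
  · cases s
    · have := G.splitVert_corner e m (G.rot.symm (f, i))
      rw [Equiv.apply_symm_apply] at this
      exact eqvGen_of_eq this.symm
    · exact eqvGen_of_eq (G.splitVert_corner e m (f, i))
  · replace hf : f ≠ e := hf
    unfold bandSwap
    split_ifs with hA
    · simp only
      rw [hm.splitVert_eq hf, hm.splitVert_eq (h := (f, !i)) hf]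
      cases i
      · exact .rel _ _ ⟨f, hA, rfl, rfl⟩
      · exact .symm _ _ (.rel _ _ ⟨f, hA, rfl, rfl⟩)
    · simp only
      exact eqvGen_of_eq
        ((hm.splitVert_eq (h := (f, i)) hf _).trans (hm.splitVert_eq (h := (f, i)) hf _).symm)

variable {G} in
/-- Boundary components cannot leave the components of the split graph if the loop is
untwisted. -/
theorem IsGap.splitJoined_of_boundaryArc {e : E} {m : ℕ} (hm : G.IsGap e m) {A : Set E}
    (ht : G.twisted e = false) {x y : (E × Bool) × Bool}
    (h : EqvGen (G.BoundaryArc (insert e A)) x y) :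
    EqvGen (G.SplitJoined e m A) (G.splitVert e m x) (G.splitVert e m y) := by
  refine eqvGen_map (G.splitVert e m) ?_ h
  intro x y h
  rcases G.cutArc_of_boundaryArc (A := A) (e := e) (fun f hf => by simp [hf]) h with
    h | ⟨h, -⟩ | ⟨-, s, rfl, rfl⟩
  · exact hm.splitJoined_of_cutArc (.rel _ _ h)
  · exact absurd (Set.mem_insert e A) h
  · rw [ht]
    cases s
    · exact eqvGen_of_eq (hm.splitVert_first_false.trans hm.splitVert_second_true.symm)
    · exact eqvGen_of_eq (hm.splitVert_first_true.trans hm.splitVert_second_false.symm)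

/-- The two parts of the vertex of the loop `e` lie in different components of the graph obtained
from `(V, A)` by splitting this vertex along `e`. -/
def Separates (e : E) (m : ℕ) (A : Set E) : Prop :=
  ¬ EqvGen (G.SplitJoined e m A) none (some (G.vert (e, false)))

variable {G} in
theorem Separates.mono {e : E} {m : ℕ} {A B : Set E} (h : G.Separates e m B) (hAB : A ⊆ B) :
    G.Separates e m A :=
  fun h' => h (EndsIn.mono hAB h')

variable {G} in
theorem Separates.f_insert [Finite E] {e : E} {m : ℕ} (hm : G.IsGap e m) {A : Set E}
    (he : e ∉ A) (h : G.Separates e m A) :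
    G.f (insert e A) = G.f A + if G.twisted e then 0 else 1 := by
  have hab : ¬ EqvGen (G.CutArc A e) ((e, false), false) ((e, false), true) := by
    intro hc
    have := hm.splitJoined_of_cutArc hc
    rw [hm.splitVert_first_false, hm.splitVert_first_true] at this
    exact h this.symm
  have hac : ¬ EqvGen (G.CutArc A e) ((e, false), false) ((e, true), false) := by
    intro hc
    have := hm.splitJoined_of_cutArc hc
    rw [hm.splitVert_first_false, hm.splitVert_second_false] at this
    exact h this.symm
  -- Cut boundary paths stay within components of the split graph, and each segment of `e` has one
  -- endpoint in each half, so only the crossing pairing survives.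
  rcases G.cutArc_pairing A e with ⟨h₁, -, -⟩ | ⟨h₁, -, -⟩ | ⟨h₁, h₂, h₃⟩
  · exact absurd h₁ hab
  · exact absurd h₁ hac
  · exact G.f_insert_of_pairing_crossing he h₁ h₂ h₃

/-- The ribbon graph obtained by giving every edge the half-twists prescribed by `t`. -/
def withTwists (t : E → Bool) : RibbonGraph V E :=
  { G with twisted := t }

theorem bandSwap_withTwists {t : E → Bool} {A : Set E} (h : ∀ f ∈ A, t f = G.twisted f) :
    (G.withTwists t).bandSwap A = G.bandSwap A := by
  funext x
  unfold bandSwap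
  split_ifs with hx
  · simp only [withTwists, h _ hx]
  · rfl

/-! ### Loops over spanning forests, and feasible sets at non-separating loops -/

variable [Finite V] [Finite E]

variable {G} in
-- The split graph has |V| + 1 vertices and still |T| edges, hence at least k(T) + 1 components; if
-- the two halves were connected, it would have at most k(T).
theorem IsForest.separates {T : Set E} (hT : G.IsForest T) (e : E) (m : ℕ) :
    G.Separates e m T := by
  intro h
  have hsv : ∀ x : (E × Bool) × Bool,
      EqvGen (G.SplitJoined e m T) (G.splitVert e m x) (some (G.vert x.1)) := by
    intro x
    rcases G.splitVert_eq_or (e := e) (m := m) x with ⟨h1, h2⟩ | h1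
    · rw [h1, h2]; exact h
    · exact eqvGen_of_eq h1
  have hle : Nat.card (Quot (G.SplitJoined e m T)) ≤ G.k T := by
    refine Nat.card_le_card_of_surjective
      (Quot.lift (fun u => Quot.mk (G.SplitJoined e m T) (some u)) ?_) ?_
    · rintro _ _ ⟨f, hf, rfl, rfl⟩
      refine quot_mk_eq_iff.2 ((hsv ((f, false), true)).symm.trans _ _ _
        (.trans _ _ _ ?_ (hsv ((f, true), true))))
      exact .rel _ _ ⟨f, hf, rfl, rfl⟩
    · rintro ⟨_ | u⟩
      · exact ⟨Quot.mk _ (G.vert (e, false)), (quot_mk_eq_iff.2 h).symm⟩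
      · exact ⟨Quot.mk _ u, rfl⟩
  have h1 := card_le_card_endsIn_add_ncard (fun f => G.splitVert e m ((f, false), true))
    (fun f => G.splitVert e m ((f, true), true)) T
  rw [Finite.card_option] at h1
  unfold IsForest at hT
  unfold SplitJoined at hle
  omega

variable {G} in
theorem IsForest.f_insert_loop {T : Set E} (hT : G.IsForest T) {e : E} (he : G.IsLoop e) :
    G.f (insert e T) = G.k T + if G.twisted e then 0 else 1 := by
  obtain ⟨m, hm⟩ := he.exists_isGap
  rw [Separates.f_insert hm (hT.notMem_of_isLoop he) (hT.separates e m), hT.f_eq_k]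

variable {G} in
/-- An untwisted loop along which the graph is not separated belongs to a spanning quasi-tree,
which consists of a spanning forest `T`, the loop and one further edge `c`. -/
theorem IsGap.exists_quasiTree {e : E} {m : ℕ} (hm : G.IsGap e m) (ht : G.twisted e = false)
    (h : ¬ G.Separates e m {e}ᶜ) :
    ∃ A, e ∉ A ∧ G.D.Feasible (insert e A) := by
  have he : G.IsLoop e := by
    unfold IsLoop
    rw [← hm.iterate, vert_rot_iterate]
  obtain ⟨T, -, -, hT, hTk⟩ :=
    IsForest.exists_spanning G.isForest_empty (Set.empty_subset Set.univ)
  have heT := hT.notMem_of_isLoop he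
  -- If no such edge existed, every connection through E \ e would already be one through `T`, which
  -- separates the halves. Adding `c` cancels the extra boundary component that `e` creates over
  -- `T`.
  obtain ⟨c, hce, hc⟩ : ∃ c, c ≠ e ∧ ¬ EqvGen (G.SplitJoined e m T)
      (G.splitVert e m ((c, false), true)) (G.splitVert e m ((c, true), true)) := by
    by_contra! hcon
    refine hT.separates e m ?_
    unfold Separates at h
    push Not at h
    refine eqvGen_of_le ?_ h
    rintro _ _ ⟨f, hf, rfl, rfl⟩
    exact hcon f hf
  have hcT : c ∉ T := fun hcT => hc (.rel _ _ ⟨c, hcT, rfl, rfl⟩)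
  refine ⟨insert c T, by simp [heT, hce.symm], ?_⟩
  have h1 := hT.f_insert_loop he
  rw [ht, if_neg (by simp)] at h1
  have h2 : G.f (insert c (insert e T)) + 1 = G.f (insert e T) := by
    refine G.f_insert_of_not_eqvGen (by simp [hcT, hce]) fun hh => hc ?_
    have := hm.splitJoined_of_boundaryArc ht hh
    rwa [hm.splitVert_eq hce, hm.splitVert_eq (h := (c, true)) hce] at this
  change G.f _ = _
  rw [Set.insert_comm]
  omega

variable {G} in
/-- For a twisted loop along which the graph is not separated, some spanning quasi-tree ceases to
be one when the loop is added or deleted. -/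
theorem IsGap.exists_feasible_symmDiff {e : E} {m : ℕ} (hm : G.IsGap e m)
    (ht : G.twisted e = true) (h : ¬ G.Separates e m {e}ᶜ) :
    ∃ F, G.D.Feasible F ∧ ¬ G.D.Feasible (symmDiff F {e}) := by
  classical
  -- Untwisting `e` changes neither the split graph nor, for sets avoiding `e`, the boundary; only
  -- the sides of `e` differ.
  let H := G.withTwists (Function.update G.twisted e false)
  have hmH : H.IsGap e m := ⟨hm.pos, hm.lt, hm.iterate⟩
  obtain ⟨A, heA, hA⟩ := hmH.exists_quasiTree (by simp [H, withTwists]) h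
  have hcut : H.CutArc A e = G.CutArc A e := by
    have hb : H.bandSwap A = G.bandSwap A := G.bandSwap_withTwists fun f hf => by
      rw [Function.update_of_ne]
      rintro rfl
      exact heA hf
    unfold CutArc
    rw [hb]
    rfl
  have hkH : H.f (insert e A) = G.k Set.univ := hA
  have hfH : H.f A = G.f A := by
    unfold f
    rw [H.card_boundary_of_notMem heA, G.card_boundary_of_notMem heA, hcut]
    rfl
  have htH : H.twisted e = false := by simp [H, withTwists]
  have hle : G.k Set.univ ≤ G.f A := (G.k_anti (Set.subset_univ A)).trans (G.k_le_f A)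
  have hadd : symmDiff A {e} = insert e A := by
    ext f; by_cases hf : f = e <;> simp [Set.mem_symmDiff, hf, heA]
  have hdel : symmDiff (insert e A) {e} = A := by rw [← hadd, symmDiff_symmDiff_cancel_right]
  rcases G.cutArc_pairing A e with ⟨h₁, h₂, h₃⟩ | ⟨h₁, h₂, h₃⟩ | ⟨h₁, h₂, h₃⟩
  · have hG := G.f_insert_of_pairing_segments heA h₁ h₂ h₃
    rw [← hcut] at h₁ h₂ h₃
    have hH := H.f_insert_of_pairing_segments heA h₁ h₂ h₃
    refine ⟨insert e A, ?_, ?_⟩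
    · change G.f _ = _
      omega
    · rw [hdel]
      change ¬ G.f _ = _
      omega
  · have hG := G.f_insert_of_pairing_parallel heA h₁ h₂ h₃
    rw [← hcut] at h₁ h₂ h₃
    have hH := H.f_insert_of_pairing_parallel heA h₁ h₂ h₃
    rw [ht] at hG
    rw [htH] at hH
    simp only [Bool.false_eq_true, if_true, if_false] at hG hH
    refine ⟨A, ?_, ?_⟩
    · change G.f _ = _
      omega
    · rw [hadd]
      change ¬ G.f _ = _
      omega
  -- This pairing is impossible: the untwisted loop would give f(A ∪ e) = f(A) + 1 > k(G),
  -- contradicting the feasibility of A ∪ e in `H`.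
  · rw [← hcut] at h₁ h₂ h₃
    have hH := H.f_insert_of_pairing_crossing heA h₁ h₂ h₃
    rw [htH] at hH
    simp only [Bool.false_eq_true, if_false] at hH
    omega

end RibbonGraph

namespace RibbonGraph

variable {V E : Type*} {G : RibbonGraph V E}

/-! ### Interlaced cycles -/

theorem eq_or_eq_opposite {h h' : E × Bool} (hh : h.1 = h'.1) : h = h' ∨ h = (h'.1, !h'.2) := by
  obtain ⟨f, i⟩ := h
  obtain ⟨g, j⟩ := h'
  obtain rfl : f = g := hh
  cases i <;> cases j <;> simp

theorem CyclicOrder.rotate {a b c d : E × Bool} (h : G.CyclicOrder a b c d) :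
    G.CyclicOrder c d a b := by
  obtain ⟨i, j, k, hi, hij, hjk, hk, rfl, rfl, rfl⟩ := h
  set p := Function.minimalPeriod G.rot a with hp
  have hper : a ∈ Function.periodicPts G.rot :=
    Function.minimalPeriod_pos_iff_mem_periodicPts.1 (by omega)
  refine ⟨k - j, p - j, p - j + i, by omega, by omega, by omega, ?_, ?_, ?_, ?_⟩
  · rw [Function.minimalPeriod_apply_iterate hper]
    omega
  · rw [← Function.iterate_add_apply, Nat.sub_add_cancel hjk.le]
  · rw [← Function.iterate_add_apply, Nat.sub_add_cancel (by omega)]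
    exact Function.iterate_minimalPeriod
  · rw [← Function.iterate_add_apply, show p - j + i + j = i + p by omega,
      Function.iterate_add_apply]
    exact congrArg _ Function.iterate_minimalPeriod

/-- Half-edges that are separated by the segments of a loop lie on different sides of it. -/
theorem IsGap.splitVert_of_cyclicOrder {e : E} {m : ℕ} (hm : G.IsGap e m) {b c d : E × Bool}
    (hc : c.1 = e) (h : G.CyclicOrder (e, false) b c d) :
    G.splitVert e m (b, true) = none ∧ G.splitVert e m (d, true) = some (G.vert d) ∧
      b.1 ≠ e ∧ d.1 ≠ e ∧ b ≠ d := by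
  obtain ⟨i, j, k, hi, hij, hjk, hk, hb, hc', hd⟩ := h
  have hinj : ∀ {s t : ℕ}, s < Function.minimalPeriod G.rot (e, false) →
      t < Function.minimalPeriod G.rot (e, false) →
      G.rot^[s] (e, false) = G.rot^[t] (e, false) → s = t := fun hs ht hst =>
    Function.iterate_injOn_Iio_minimalPeriod (Set.mem_Iio.2 hs) (Set.mem_Iio.2 ht) hst
  have hce : c = (e, true) := by
    rcases eq_or_eq_opposite (h := c) (h' := (e, false)) hc with h | h
    · have := hinj (s := j) (t := 0) (by omega) (by omega) (hc'.trans h)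
      omega
    · exact h
  have hjm : j = m := hinj (by omega) hm.lt (by rw [hc', hce, hm.iterate])
  refine ⟨if_pos ⟨i, hb, by simp; omega⟩, if_neg ?_, ?_, ?_, ?_⟩
  · rintro ⟨t, ht, htm⟩
    simp only [if_true] at ht htm
    have := hinj (s := t) (t := k) (by omega) hk (ht.trans hd.symm)
    omega
  · intro hbe
    rcases eq_or_eq_opposite (h := b) (h' := (e, false)) hbe with h | h
    · have := hinj (s := i) (t := 0) (by omega) (by omega) (hb.trans h)
      omega
    · have := hinj (s := i) (t := j) (by omega) (by omega) (by rw [hb, h, hc', hce]; rfl)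
      omega
  · intro hde
    rcases eq_or_eq_opposite (h := d) (h' := (e, false)) hde with h | h
    · have := hinj (s := k) (t := 0) hk (by omega) (hd.trans h)
      omega
    · have := hinj (s := k) (t := j) hk (by omega) (by rw [hd, h, hc', hce]; rfl)
      omega
  · intro hbd
    have := hinj (s := i) (t := k) (by omega) hk (by rw [hb, hd, hbd])
    omega

/-- The cycle leaves the vertex of `e` from one side of the loop and returns on the other, so in the
split graph it becomes a walk joining the two halves. -/
theorem IsGap.not_separates_of_interlaced {e : E} {m : ℕ} (hm : G.IsGap e m) {C : Set E}
    (hC : G.IsCycle C) (hI : G.Interlaced {e} C) : ¬ G.Separates e m {e}ᶜ := by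
  obtain ⟨v, hv, a, b, c, d, ha, hb, hc, hd, hav, hcyc⟩ := hI
  have hloop : G.vert (e, true) = G.vert (e, false) := by rw [← hm.iterate, vert_rot_iterate]
  have hve : v = G.vert (e, false) := by
    rcases eq_or_eq_opposite (h := a) (h' := (e, false)) ha with rfl | rfl
    · exact hav.symm
    · exact hav.symm.trans hloop
  subst hve
  clear hav
  -- rotate the cyclic order so that it starts at the first segment of `e`
  obtain ⟨b, c, d, hb, hc, hd, hcyc⟩ : ∃ b c d : E × Bool, b.1 ∈ C ∧ c.1 = e ∧ d.1 ∈ C ∧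
      G.CyclicOrder (e, false) b c d := by
    rcases eq_or_eq_opposite (h := a) (h' := (e, false)) ha with rfl | rfl
    · exact ⟨b, c, d, hb, hc, hd, hcyc⟩
    · rcases eq_or_eq_opposite (h := c) (h' := (e, false)) hc with rfl | rfl
      · exact ⟨d, _, b, hd, rfl, hb, hcyc.rotate⟩
      · obtain ⟨i, j, k, hi, hij, hjk, hk, -, hj, -⟩ := hcyc
        have := Function.IsPeriodicPt.minimalPeriod_le (f := G.rot) (n := j) (by omega) hj
        omega
  obtain ⟨hbs, hds, hbe, hde, hbd⟩ := hm.splitVert_of_cyclicOrder hc hcyc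
  have hbv : G.vert b = G.vert (e, false) := by
    obtain ⟨i, j, k, -, -, -, -, rfl, -, -⟩ := hcyc
    exact G.vert_rot_iterate _ _
  have hdv : G.vert d = G.vert (e, false) := by
    obtain ⟨i, j, k, -, -, -, -, -, -, rfl⟩ := hcyc
    exact G.vert_rot_iterate _ _
  obtain ⟨n, h, hinjE, hinjV, hstep, rfl⟩ := hC
  have hat : ∀ x : E × Bool, x.1 ∈ Set.range (fun i => (h i).1) →
      G.vert x = G.vert (e, false) → ∃ i, G.vert (h i) = G.vert (e, false) ∧
        (x = h i ∨ x = ((h (i - 1)).1, !(h (i - 1)).2)) := by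
    rintro x ⟨j, hj⟩ hx
    rcases eq_or_eq_opposite (h := x) (h' := h j) hj.symm with rfl | rfl
    · exact ⟨j, hx, Or.inl rfl⟩
    · exact ⟨j + 1, (hstep j).symm.trans hx, Or.inr (by rw [add_sub_cancel_right])⟩
  obtain ⟨i, hi, hbi⟩ := hat b hb hbv
  have hat' : ∀ x : E × Bool, x.1 ∈ Set.range (fun i => (h i).1) →
      G.vert x = G.vert (e, false) → x = h i ∨ x = ((h (i - 1)).1, !(h (i - 1)).2) := by
    intro x hx hxv
    obtain ⟨j, hj, h'⟩ := hat x hx hxv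
    obtain rfl : j = i := hinjV (hj.trans hi.symm)
    exact h'
  have hdi := hat' d hd hdv
  -- A cycle has only two half-edges at the vertex, and `b` and `d` already occupy both.
  have heC : ∀ j, (h j).1 ≠ e := by
    intro j hj
    have h0 := hat' (e, false) ⟨j, hj⟩ rfl
    have hb0 : b ≠ (e, false) := fun h' => hbe (by rw [h'])
    have hd0 : d ≠ (e, false) := fun h' => hde (by rw [h'])
    rcases h0 with h0 | h0 <;> rcases hbi with hbi | hbi <;> rcases hdi with hdi | hdi <;>
      first
      | exact hb0 (hbi.trans h0.symm)
      | exact hd0 (hdi.trans h0.symm)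
      | exact hbd (hbi.trans hdi.symm)
  have hedge : ∀ j, EqvGen (G.SplitJoined e m {e}ᶜ) (G.splitVert e m (h j, true))
      (G.splitVert e m (((h j).1, !(h j).2), true)) := by
    intro j
    have hj : (h j).1 ∈ ({e}ᶜ : Set E) := heC j
    generalize h j = x at hj
    obtain ⟨f, _ | _⟩ := x
    · exact .rel _ _ ⟨f, hj, rfl, rfl⟩
    · exact .symm _ _ (.rel _ _ ⟨f, hj, rfl, rfl⟩)
  let t : ℕ → Fin (n + 1) := Fin.ofNat (n + 1)
  have ht0 : ∀ j, t j = 0 ↔ n + 1 ∣ j := fun j => by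
    rw [Fin.ext_iff, Nat.dvd_iff_mod_eq_zero]
    rfl
  have ht1 : ∀ j, t (j + 1) = t j + 1 := fun j => by
    simp [t, Fin.ext_iff, Fin.val_add]
  -- Go once around the cycle from `h i`: the intermediate vertices differ from the vertex of `e`,
  -- so the split leaves them intact.
  have hpath : ∀ j : ℕ, j ≤ n → EqvGen (G.SplitJoined e m {e}ᶜ) (G.splitVert e m (h i, true))
      (G.splitVert e m (((h (i + t j)).1, !(h (i + t j)).2), true)) := by
    intro j
    induction j with
    | zero =>
      intro _
      rw [(ht0 0).2 (dvd_zero _), add_zero]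
      exact hedge i
    | succ j ih =>
      intro hj
      have hne : G.vert (h (i + t j + 1)) ≠ G.vert (e, false) := by
        rw [← hi]
        intro h'
        have h'' := hinjV h'
        rw [add_assoc, add_eq_left, ← ht1, ht0] at h''
        exact absurd (Nat.le_of_dvd (by omega) h'') (by omega)
      have heq : G.splitVert e m (((h (i + t j)).1, !(h (i + t j)).2), true) =
          G.splitVert e m (h (i + t j + 1), true) := by
        rcases G.splitVert_eq_or (e := e) (m := m) (h (i + t j + 1), true) with h1 | h1
        · exact absurd h1.2 hne
        · rcases G.splitVert_eq_or (e := e) (m := m)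
            (((h (i + t j)).1, !(h (i + t j)).2), true) with h2 | h2
          · exact absurd ((hstep _).symm.trans h2.2) hne
          · rw [h1, h2]
            exact congrArg some (hstep _)
      have h4 := ih (by omega)
      rw [heq] at h4
      rw [ht1, ← add_assoc]
      exact h4.trans _ _ _ (hedge _)
  have hfinal := hpath n le_rfl
  have hlast : i + t n = i - 1 := by
    rw [eq_sub_iff_add_eq, add_assoc, add_eq_left, ← ht1, ht0]
  rw [hlast] at hfinal
  rw [hdv] at hds
  unfold Separates
  rw [not_not, ← hbs, ← hds]
  rcases hbi with hbi | hbi <;> rcases hdi with hdi | hdi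
  · exact absurd (hbi.trans hdi.symm) hbd
  · rw [hbi, hdi]; exact hfinal
  · rw [hbi, hdi]; exact hfinal.symm
  · exact absurd (hbi.trans hdi.symm) hbd

/-- Gluing the two halves back together closes a simple path between them into a cycle; its first
and last half-edges lie on opposite sides of the loop. -/
theorem IsGap.exists_interlaced [Finite E] {e : E} {m : ℕ} (hm : G.IsGap e m)
    (h : ¬ G.Separates e m {e}ᶜ) : ∃ C, G.IsCycle C ∧ G.Interlaced {e} C := by
  classical
  have hloop : G.vert (e, true) = G.vert (e, false) := by rw [← hm.iterate, vert_rot_iterate]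
  let S := SimpleGraph.fromRel (G.SplitJoined e m {e}ᶜ)
  have hreach : ∀ {x y}, EqvGen (G.SplitJoined e m {e}ᶜ) x y → S.Reachable x y := by
    intro x y h
    induction h with
    | rel x y hr =>
      by_cases hxy : x = y
      · rw [hxy]
      · exact SimpleGraph.Adj.reachable ((SimpleGraph.fromRel_adj _ _ _).2 ⟨hxy, Or.inl hr⟩)
    | refl => exact SimpleGraph.Reachable.refl _
    | symm _ _ _ ih => exact ih.symm
    | trans _ _ _ _ _ ih₁ ih₂ => exact ih₁.trans ih₂
  obtain ⟨p, hp⟩ := (hreach (not_not.1 h)).exists_isPath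
  obtain ⟨n, hn⟩ : ∃ n, p.length = n + 1 := by
    refine ⟨p.length - 1, ?_⟩
    have : p.length ≠ 0 := fun h0 => by simpa using SimpleGraph.Walk.eq_of_length_eq_zero h0
    omega
  have hinj : ∀ {i j : ℕ}, i ≤ n + 1 → j ≤ n + 1 → p.getVert i = p.getVert j → i = j :=
    fun hi hj hij => hp.getVert_injOn (by simpa [hn] using hi) (by simpa [hn] using hj) hij
  have hhalf : ∀ i : Fin (n + 1), ∃ x : E × Bool, x.1 ≠ e ∧
      G.splitVert e m (x, true) = p.getVert i ∧
      G.splitVert e m ((x.1, !x.2), true) = p.getVert (i + 1) := by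
    intro i
    have hadj := p.adj_getVert_succ (i := i) (by omega)
    rcases ((SimpleGraph.fromRel_adj _ _ _).1 hadj).2 with ⟨f, hf, h1, h2⟩ | ⟨f, hf, h1, h2⟩
    · exact ⟨(f, false), hf, h1, h2⟩
    · exact ⟨(f, true), hf, h2, h1⟩
  choose x hxe hx hx' using hhalf
  have hvert : ∀ i, G.vert (x i) = (p.getVert i).getD (G.vert (e, false)) := fun i => by
    rw [← hx, getD_splitVert]
  have hvert' : ∀ i, G.vert ((x i).1, !(x i).2) =
      (p.getVert (i + 1)).getD (G.vert (e, false)) := fun i => by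
    rw [← hx', getD_splitVert]
  have hend : p.getVert (n + 1) = some (G.vert (e, false)) := by rw [← hn, p.getVert_length]
  have h0 : G.vert (x 0) = G.vert (e, false) := by
    rw [hvert]
    simp
  have hlast : G.vert ((x (Fin.last n)).1, !(x (Fin.last n)).2) = G.vert (e, false) := by
    rw [hvert', Fin.val_last, hend]
    rfl
  have hcycle : G.IsCycle (Set.range fun i => (x i).1) := by
    refine ⟨n, x, ?_, ?_, ?_, rfl⟩
    · intro i j hij
      rcases eq_or_eq_opposite (h := x i) (h' := x j) hij with h | h
      · refine Fin.ext (hinj (by omega) (by omega) ?_)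
        rw [← hx, ← hx, h]
      · have h1 : (i : ℕ) = j + 1 := hinj (by omega) (by omega) (by rw [← hx, ← hx', h])
        have h2 : (i : ℕ) + 1 = j := by
          refine hinj (by omega) (by omega) ?_
          rw [← hx, ← hx', h]
          simp
        omega
    · intro i j hij
      simp only [hvert] at hij
      -- Gluing, that is `getD`, identifies `none` only with this vertex, which the path reaches
      -- only at position `n + 1`; so the positions up to `n` stay distinct.
      have hne : ∀ k : Fin (n + 1), p.getVert k ≠ some (G.vert (e, false)) := by
        intro k hk
        have := hinj (i := k) (j := n + 1) (by omega) le_rfl (hk.trans hend.symm)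
        omega
      refine Fin.ext (hinj (by omega) (by omega) ?_)
      have hi := hne i
      have hj := hne j
      revert hij hi hj
      cases p.getVert i <;> cases p.getVert j <;> simp +contextual [eq_comm]
    · intro i
      induction i using Fin.lastCases with
      | last => rw [hlast, Fin.last_add_one, h0]
      | cast i => rw [hvert', hvert, Fin.coeSucc_eq_succ]; rfl
  refine ⟨_, hcycle, G.vert (e, false), ?_, (e, false), x 0, (e, true),
    ((x (Fin.last n)).1, !(x (Fin.last n)).2), rfl, ⟨0, rfl⟩, rfl, ⟨Fin.last n, rfl⟩, rfl, ?_⟩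
  · refine Set.Subset.antisymm ?_ ?_
    · rintro u ⟨⟨⟨f, i⟩, hf, rfl⟩, -⟩
      obtain rfl : f = e := hf
      cases i
      exacts [rfl, hloop]
    · rintro u rfl
      exact ⟨⟨(e, false), rfl, rfl⟩, ⟨x 0, ⟨0, rfl⟩, h0⟩⟩
  · have hgap : G.InGap e m (x 0, true) := by
      by_contra hg
      have h1 : G.splitVert e m (x 0, true) = some _ := if_neg hg
      rw [hx] at h1
      simp at h1
    obtain ⟨i, hi, him⟩ := hgap
    simp only [if_true] at hi him
    obtain ⟨k, hk, hk'⟩ := G.exists_iterate_of_vert_eq hlast.symm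
    have hngap : ¬ G.InGap e m (((x (Fin.last n)).1, !(x (Fin.last n)).2), true) := by
      intro hg
      have h1 : G.splitVert e m (((x (Fin.last n)).1, !(x (Fin.last n)).2), true) = none :=
        if_pos hg
      rw [hx', Fin.val_last, hend] at h1
      simp at h1
    have hi0 : i ≠ 0 := by
      rintro rfl
      exact hxe 0 (by rw [← hi]; rfl)
    have hkm : ¬ k < m := fun hkm => hngap ⟨k, hk', by simpa using hkm⟩
    have hkm' : k ≠ m := by
      rintro rfl
      rw [hm.iterate] at hk'
      exact hxe (Fin.last n) (congrArg Prod.fst hk').symm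
    exact ⟨i, m, k, by omega, him, by omega, hk, hi, hm.iterate, hk'⟩

theorem IsGap.isTrivialLoop_iff [Finite E] {e : E} {m : ℕ} (hm : G.IsGap e m) :
    G.IsTrivialLoop e ↔ G.Separates e m {e}ᶜ := by
  have hloop : G.IsLoop e := by
    unfold IsLoop
    rw [← hm.iterate, vert_rot_iterate]
  constructor
  · rintro ⟨-, h⟩
    by_contra hs
    obtain ⟨C, hC, hI⟩ := hm.exists_interlaced hs
    exact h C hC hI
  · exact fun hs => ⟨hloop, fun C hC hI => hm.not_separates_of_interlaced hC hI hs⟩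

/-! ### Ribbon loops of the delta-matroid -/

variable [Finite V] [Finite E]

/-- For a loop, being a ribbon loop of the twist detects the half-twist. -/
theorem IsLoop.twist_isRibbonLoop_iff {e : E} (he : G.IsLoop e) :
    (G.D.twist {e}).IsRibbonLoop e ↔ G.twisted e = true := by
  obtain ⟨T, -, -, hT, hTk⟩ :=
    IsForest.exists_spanning G.isForest_empty (Set.empty_subset Set.univ)
  have heT := hT.notMem_of_isLoop he
  have hins : ∀ {X : Set E}, e ∉ X → symmDiff {e} X = insert e X := by
    intro X hX
    ext f
    by_cases hf : f = e <;> simp [Set.mem_symmDiff, hf, hX]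
  have hcard : ∀ {X : Set E}, e ∉ X → (symmDiff {e} X).ncard = X.ncard + 1 := fun hX => by
    rw [hins hX, Set.ncard_insert_of_notMem hX]
  constructor
  · intro hr
    by_contra ht
    refine hr (symmDiff {e} T) ⟨⟨T, hT.feasible hTk, rfl⟩, ?_⟩ (by rw [hins heT]; simp)
    rintro _ ⟨X, hX, rfl⟩
    rw [hcard heT]
    have hXk := G.k_eq_of_feasible hX
    by_cases heX : e ∈ X
    · obtain ⟨Y, heY, rfl⟩ : ∃ Y, e ∉ Y ∧ insert e Y = X :=
        ⟨X \ {e}, by simp, by simp [Set.insert_eq_of_mem heX]⟩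
      rw [← hins heY, symmDiff_symmDiff_cancel_left]
      rw [G.k_insert_of_eqvGen (eqvGen_of_eq he)] at hXk
      -- Equality would make `Y` a spanning forest, and then adding the untwisted loop would give
      -- k(G) + 1 boundary components.
      refine lt_of_le_of_ne (hT.ncard_le hTk hXk) fun heq => ?_
      have hY : G.IsForest Y := by
        unfold IsForest at *
        rw [← heq, hXk, ← hTk, hT]
      have h1 := hY.f_insert_loop he
      rw [if_neg ht, show G.f (insert e Y) = _ from hX] at h1
      omega
    · rw [hcard heX]
      exact Nat.succ_le_succ (hT.ncard_le hTk hXk)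
  · rintro ht _ ⟨⟨X, hX, rfl⟩, hmin⟩ heX
    have heX' : e ∉ X := by
      intro h
      simp [Set.mem_symmDiff, h] at heX
    have h1 : G.D.Feasible (insert e T) := by
      change G.f _ = _
      rw [hT.f_insert_loop he, if_pos ht, hTk, add_zero]
    -- For a twisted loop `insert e T` is feasible, so `T` itself is feasible in the twist and is
    -- smaller than any twisted set containing `e`.
    have h2 := hmin T ⟨insert e T, h1, by rw [← hins heT, symmDiff_symmDiff_cancel_left]⟩
    rw [hcard heX'] at h2
    have h3 := hT.ncard_le hTk (G.k_eq_of_feasible hX)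
    omega

theorem isOrientableLoop_iff (e : E) :
    G.IsOrientableLoop e ↔ G.D.IsOrientableRibbonLoop e := by
  unfold IsOrientableLoop SetSystem.IsOrientableRibbonLoop
  rw [← G.isLoop_iff_isRibbonLoop]
  refine and_congr_right fun he => ?_
  rw [he.twist_isRibbonLoop_iff, Bool.not_eq_true]

theorem isNonorientableRibbonLoop_iff (e : E) :
    G.D.IsNonorientableRibbonLoop e ↔ G.IsLoop e ∧ G.twisted e = true := by
  unfold SetSystem.IsNonorientableRibbonLoop
  rw [← G.isLoop_iff_isRibbonLoop]
  exact and_congr_right fun he => he.twist_isRibbonLoop_iff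

/-- If E \ e separates the halves, f(A ∪ e) = f(A) + 1 > k(G) for every A avoiding e; if not, a
quasi-tree through e exists. -/
theorem IsOrientableLoop.isTrivialLoop_iff {e : E} (he : G.IsOrientableLoop e) :
    G.IsTrivialLoop e ↔ G.D.IsLoop e := by
  obtain ⟨m, hm⟩ := he.1.exists_isGap
  rw [hm.isTrivialLoop_iff]
  constructor
  · intro hs F hF heF
    obtain ⟨A, heA, rfl⟩ : ∃ A, e ∉ A ∧ insert e A = F :=
      ⟨F \ {e}, by simp, by simp [Set.insert_eq_of_mem heF]⟩
    have h1 := Separates.f_insert hm heA (hs.mono (by simpa using heA))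
    rw [he.2, if_neg (by simp), show G.f (insert e A) = _ from hF] at h1
    have h2 := G.k_anti (Set.subset_univ A)
    have h3 := G.k_le_f A
    omega
  · intro hl
    by_contra hs
    obtain ⟨A, -, hA⟩ := hm.exists_quasiTree he.2 hs
    exact hl _ hA (Set.mem_insert e A)

theorem IsLoop.isTrivialLoop_iff_of_twisted {e : E} (he : G.IsLoop e)
    (ht : G.twisted e = true) :
    G.IsTrivialLoop e ↔ ∀ F, G.D.Feasible F → G.D.Feasible (symmDiff F {e}) := by
  obtain ⟨m, hm⟩ := he.exists_isGap
  rw [hm.isTrivialLoop_iff]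
  constructor
  · intro hs F hF
    have key : ∀ A : Set E, e ∉ A → G.f (insert e A) = G.f A := fun A heA => by
      rw [Separates.f_insert hm heA (hs.mono (by simpa using heA)), if_pos ht, add_zero]
    have hins : ∀ A : Set E, e ∉ A → symmDiff A {e} = insert e A := by
      intro A heA
      ext f
      by_cases hf : f = e <;> simp [Set.mem_symmDiff, hf, heA]
    by_cases heF : e ∈ F
    · obtain ⟨A, heA, rfl⟩ : ∃ A, e ∉ A ∧ insert e A = F :=
        ⟨F \ {e}, by simp, by simp [Set.insert_eq_of_mem heF]⟩
      rw [← hins A heA, symmDiff_symmDiff_cancel_right]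
      exact (key A heA).symm.trans hF
    · rw [hins F heF]
      exact (key F heF).trans hF
  · intro h
    by_contra hs
    obtain ⟨F, hF, hF'⟩ := hm.exists_feasible_symmDiff ht hs
    exact hF' (h F hF)

theorem isTrivialLoop_iff_isTrivialRibbonLoop (e : E) :
    G.IsTrivialLoop e ↔ G.D.IsTrivialRibbonLoop e := by
  unfold SetSystem.IsTrivialRibbonLoop
  rw [← isOrientableLoop_iff, isNonorientableRibbonLoop_iff]
  constructor
  · intro h
    cases ht : G.twisted e
    · exact Or.inl ⟨⟨h.1, ht⟩, (IsOrientableLoop.isTrivialLoop_iff ⟨h.1, ht⟩).1 h⟩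
    · exact Or.inr ⟨⟨h.1, rfl⟩, (h.1.isTrivialLoop_iff_of_twisted ht).1 h⟩
  · rintro (⟨ho, h⟩ | ⟨⟨hl, ht⟩, h⟩)
    · exact ho.isTrivialLoop_iff.2 h
    · exact (hl.isTrivialLoop_iff_of_twisted ht).2 h

theorem isLoop_D_iff (e : E) :
    G.D.IsLoop e ↔ G.IsTrivialLoop e ∧ G.IsOrientableLoop e := by
  constructor
  · intro h
    have hl : G.IsLoop e := (G.isLoop_iff_isRibbonLoop e).2 fun F hF => h F hF.1
    have ht : G.twisted e = false := by
      by_contra ht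
      rw [Bool.not_eq_false] at ht
      obtain ⟨T, -, -, hT, hTk⟩ :=
        IsForest.exists_spanning G.isForest_empty (Set.empty_subset Set.univ)
      refine h (insert e T) ?_ (Set.mem_insert e T)
      change G.f _ = _
      rw [hT.f_insert_loop hl, if_pos ht, hTk, add_zero]
    have ho : G.IsOrientableLoop e := ⟨hl, ht⟩
    exact ⟨ho.isTrivialLoop_iff.2 h, ho⟩
  · rintro ⟨h, ho⟩
    exact ho.isTrivialLoop_iff.1 h

end RibbonGraph

theorem propositionp {V E : Type*} [Finite V] [Finite E] (G : RibbonGraph V E) (e : E) :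
    (G.IsLoop e ↔ G.D.IsRibbonLoop e) ∧
    (G.IsOrientableLoop e ↔ G.D.IsOrientableRibbonLoop e) ∧
    (G.IsTrivialLoop e ↔ G.D.IsTrivialRibbonLoop e) ∧
    (G.D.IsColoop e ↔ G.IsBridge e) ∧
    (G.D.IsLoop e ↔ G.IsTrivialLoop e ∧ G.IsOrientableLoop e) :=
  ⟨G.isLoop_iff_isRibbonLoop e, RibbonGraph.isOrientableLoop_iff e,
    RibbonGraph.isTrivialLoop_iff_isTrivialRibbonLoop e, G.isColoop_iff_isBridge e,
    RibbonGraph.isLoop_D_iff e⟩
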